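/- **Setting.** Let $N,R\ge 1$. The computational qubits are arranged in $R$ rows of $N$ qubits, $M=RN$ in total, $q=(r,j)$ being the qubit in row $r$ and column $j$. A set $Q_{\rm in}$ of $n$ qubits of the first row carries the input, and $q_{\rm out}$ is the rightmost qubit of the last row. The verifying circuit $V_x$ consists of one unitary gate $G_r$ on one or two qubits of row $r$, for each $r=1,\dots,R$, and is executed in $T=(2R-1)N$ steps $U_1,\dots,U_T$: in the $r$-th gate round a cursor visits the qubits of row $r$ from left to right, one per step, where $G_r$ is applied when the cursor reaches its leftmost qubit and every other step is an identity operation (on the visited qubit or, if $G_r$ has already acted on that qubit, on no qubit); after the $r$-th gate round, for $r<R$, the qubits of row $r$ are swapped with those of row $r+1$, column by column from right to left, one per step. Let $t_q$ be the first time at which a step acts on $q$ (identity operations on $q$ included). On input a normalized state $|\xi\rangle$ of the qubits in $Q_{\rm in}$ put $|\xi_0\rangle=|\xi\rangle|0^{M-n}\rangle$ and $|\xi_t\rangle=U_t|\xi_{t-1}\rangle$; $V_x$ accepts with the probability that a measurement of $q_{\rm out}$ in $|\xi_T\rangle$ gives $1$. Add clock qubits $c_1,\dots,c_T$ and let $$H^{(5)}=H_{\rm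 in}+H_{\rm out}+H_{\rm clock}+\tfrac12\sum_{t=1}^{T}H_{\rm evolv}(t),$$ $$H_{\rm in}=\sum_{q\notin Q_{\rm in}}|1\rangle\langle 1|_q\otimes|100\rangle\langle100|_{c_{t_q-1},c_{t_q},c_{t_q+1}},\quad H_{\rm out}=|0\rangle\langle0|_{q_{\rm out}}\otimes|1\rangle\langle1|_{c_T},\quad H_{\rm clock}=\sum_{t=1}^{T-1}|01\rangle\langle01|_{c_t,c_{t+1}},$$ $$H_{\rm evolv}(t)=|100\rangle\langle100|+|110\rangle\langle110|-U_t\otimes|110\rangle\langle100|-U_t^\dagger\otimes|100\rangle\langle110|\quad\text{on } c_{t-1},c_t,c_{t+1},$$ where at the boundaries the missing bits are read as $c_0=1$, $c_{T+1}=0$ (so e.g. $|100\rangle\langle100|$ means $|00\rangle\langle00|_{c_1,c_2}$ for $t=1$ and $|10\rangle\langle10|_{c_{T-1},c_T}$ for $t=T$). The interaction hypergraph has all $M+T$ qubits as vertices and, for every term of these sums, one hyperedge, consisting of the qubits on which the term acts nontrivially. It is spatially sparse with bound $K$ if every vertex lies in at most $K$ hyperedges and the vertices can be placed in the plane, at mutual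 distances at least $1$, such that the convex hull of every hyperedge has area at most $K$ and meets the convex hulls of at most $K$ other hyperedges. **Lemma.** There are universal constants $c>0$ and $K$ such that for all $N,R\ge1$ and all such circuits $H^{(5)}$ is Hermitian, every hyperedge has at most $5$ vertices, the interaction hypergraph is spatially sparse with bound $K$ provided that all two-qubit gates $G_r$ act on neighbouring qubits of their row, and, for every real $\epsilon$: 1. If $V_x$ accepts some input $|\xi\rangle$ with probability more than $1-\epsilon$, then the history state $|\psi\rangle=\sqrt{\tfrac1{T+1}}\sum_{t=0}^T|\xi_t\rangle|1^t0^{T-t}\rangle_{c_1\dots c_T}$ satisfies $\langle\psi|H^{(5)}|\psi\rangle<\frac{\epsilon}{T+1}$. 2. If $V_x$ accepts every input $|\xi\rangle$ with probability less than $\epsilon$, then all eigenvalues of $H^{(5)}$ are at least $\frac{c(1-\epsilon-\sqrt\epsilon)}{T^3}$. -/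

import Mathlib

open scoped Matrix Kronecker

noncomputable section

/-! ### Qubit registers, operators, locality -/

/-- Labels of the computational basis of a register of qubits indexed by `V`. -/
abbrev Config (V : Type*) := V → Fin 2

/-- Operators on the qubit register indexed by `V`, as matrices in the computational basis. -/
abbrev QOp (V : Type*) := Matrix (Config V) (Config V) ℂ

/-- A normalized pure state of a register. -/
def IsState {V : Type*} [Fintype V] [DecidableEq V] (ψ : Config V → ℂ) : Prop :=
  ∑ x, ‖ψ x‖ ^ 2 = 1

open Classical in
/-- The operator `A` applied to the qubits `f 0, …, f (k - 1)`, tensored with the identity on all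
other qubits. -/
def onQubits {V : Type*} {k : ℕ} (f : Fin k ↪ V) (A : QOp (Fin k)) : QOp V :=
  Matrix.of fun x y => if ∀ v, v ∉ Set.range f → x v = y v then A (x ∘ f) (y ∘ f) else 0

/-- The swap gate exchanging the qubits `q` and `q'`. -/
def swapOp {V : Type*} [Fintype V] [DecidableEq V] (q q' : V) : QOp V :=
  Matrix.of fun x y => if x = y ∘ Equiv.swap q q' then 1 else 0

/-- The projector `|b⟩⟨b|` on the qubit `q`, tensored with the identity on all other qubits. -/
def bitProj {V : Type*} [Fintype V] [DecidableEq V] (q : V) (b : Fin 2) : QOp V :=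
  Matrix.diagonal fun x => if x q = b then 1 else 0

/-- The tensor product `A ⊗ B` as an operator on the union of two registers. -/
def tensorOp {V W : Type*} (A : QOp V) (B : QOp W) : QOp (V ⊕ W) :=
  (A ⊗ₖ B).submatrix (Equiv.sumArrowEquivProdArrow V W (Fin 2))
    (Equiv.sumArrowEquivProdArrow V W (Fin 2))

/-- `A` is of the form `A' ⊗ I`, with the identity acting on the qubit `v`. -/
def ActsTriviallyOn {V : Type*} [DecidableEq V] (A : QOp V) (v : V) : Prop :=
  ∀ x y : Config V,
    A x y = if x v = y v then A (Function.update x v 0) (Function.update y v 0) else 0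

/-- The set of qubits on which `A` acts nontrivially. -/
def opSupport {V : Type*} [DecidableEq V] (A : QOp V) : Set V :=
  {v | ¬ ActsTriviallyOn A v}

/-- Spatial sparsity, with the explicit bound `K`, of the hypergraph on the vertex set `V` with
hyperedges `edge i`: every vertex lies in at most `K` hyperedges, and there is a straight-line
drawing in the plane in which every hyperedge overlaps with at most `K` others and covers an area
of at most `K`. A hyperedge is drawn as the convex polygon spanned by its vertices. Distinct
vertices are drawn at distance at least `1`; this fixes the scale of the drawing, without which the
bound on the area could always be achieved by shrinking. -/
structure IsSpatiallySparse {V I : Type*} (edge : I → Set V) (K : ℕ) : Prop where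
  degree_le : ∀ v, {i | v ∈ edge i}.encard ≤ K
  exists_drawing : ∃ pos : V → EuclideanSpace ℝ (Fin 2),
    (∀ v w, v ≠ w → 1 ≤ dist (pos v) (pos w)) ∧
    (∀ i, {j | j ≠ i ∧
      (convexHull ℝ (pos '' edge i) ∩ convexHull ℝ (pos '' edge j)).Nonempty}.encard ≤ K) ∧
    (∀ i, MeasureTheory.volume (convexHull ℝ (pos '' edge i)) ≤ K)

/-! ### The verifying circuit, laid out in rows -/

/-- A one- or two-qubit unitary gate on distinct wires of a row of `N` qubits. -/
structure Gate (N : ℕ) where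
  arity : ℕ
  arity_pos : 1 ≤ arity
  arity_le : arity ≤ 2
  wires : Fin arity ↪ Fin N
  U : Matrix.unitaryGroup (Config (Fin arity)) ℂ

/-- A circuit of `R` rounds on `N` qubits, with one gate per round; the input register consists of
the qubits of the first row in the columns `inputs`. -/
structure VerifierCircuit (N R : ℕ) where
  gate : Fin R → Gate N
  inputs : Finset (Fin N)

/-- The actions of the cursor: visiting the qubit in row `r` and column `j` during a gate round, or
swapping the qubits of rows `r` and `r'` in column `j`. -/
inductive Step (N R : ℕ) where
  | gate (r : Fin R) (j : Fin N)
  | swap (r r' : Fin R) (j : Fin N)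

/-- Computational qubits: `R` rows (numbered from `0`) of `N` qubits. -/
abbrev CompQubit (N R : ℕ) := Fin R × Fin N

/-- The number `T` of time steps: `R` gate rounds and `R - 1` swap rounds, of `N` steps each. -/
def numSteps (N R : ℕ) : ℕ := (2 * R - 1) * N

/-- The clock qubits; the index `s` stands for `c_{s+1}`. -/
abbrev ClockQubit (N R : ℕ) := Fin (numSteps N R)

/-- All the qubits of the Hamiltonian. -/
abbrev Qubit (N R : ℕ) := CompQubit N R ⊕ ClockQubit N R

/-- The action of the cursor at time `t`, for `1 ≤ t ≤ T`: gate rounds run from left to right, and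
the swap rounds between them from right to left. -/
def step (N R : ℕ) [NeZero N] [NeZero R] (t : ℕ) : Step N R :=
  let b := (t - 1) / N
  let p := (t - 1) % N
  if b % 2 = 0 then
    Step.gate (Fin.ofNat R (b / 2)) (Fin.ofNat N p)
  else
    Step.swap (Fin.ofNat R (b / 2)) (Fin.ofNat R (b / 2 + 1)) (Fin.ofNat N (N - 1 - p))

namespace VerifierCircuit

variable {N R : ℕ} (C : VerifierCircuit N R)

/-- Embedding of the columns as the qubits of row `r`. -/
def rowEmb (r : Fin R) : Fin N ↪ CompQubit N R :=
  ⟨fun j => (r, j), fun _ _ h => (Prod.ext_iff.1 h).2⟩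

open Classical in
/-- The unitary performed in one cursor step. The gate of a round is performed when the cursor
reaches the leftmost of its wires; the other steps of a gate round are identity operations. -/
def stepOp : Step N R → QOp (CompQubit N R)
  | .gate r j =>
      if IsLeast (Set.range (C.gate r).wires) j then
        onQubits ((C.gate r).wires.trans (rowEmb r)) (C.gate r).U
      else 1
  | .swap r r' j => swapOp (r, j) (r', j)

open Classical in
/-- The qubits acted on (possibly by an identity gate) in one cursor step. When the cursor visits a
wire of the gate that has been performed before in the same round, only time advances. -/
def stepQubits : Step N R → Set (CompQubit N R)
  | .gate r j =>
      if IsLeast (Set.range (C.gate r).wires) j then rowEmb r '' Set.range (C.gate r).wires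
      else if j ∈ Set.range (C.gate r).wires then ∅
      else {(r, j)}
  | .swap r r' j => {(r, j), (r', j)}

/-- All two-qubit gates act on neighbouring qubits of their row. -/
def NearestNeighbour : Prop :=
  ∀ r i i', ((C.gate r).wires i : ℕ) ≤ (C.gate r).wires i' + 1

/-- The input qubits `Q_in`. -/
def Qin [NeZero R] : Set (CompQubit N R) := {q | q.1 = 0 ∧ q.2 ∈ C.inputs}

/-- The state `|ξ⟩|0…0⟩` of the computational qubits. -/
def initState [NeZero R] (ξ : Config C.inputs → ℂ) : Config (CompQubit N R) → ℂ :=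
  open Classical in
  fun x => if ∀ q, q ∉ C.Qin → x q = 0 then ξ (fun j => x (0, j)) else 0

variable [NeZero N] [NeZero R]

/-- The operation `U_t`, for `1 ≤ t ≤ T`. -/
def U (t : ℕ) : QOp (CompQubit N R) := C.stepOp (step N R t)

/-- The states `|ξ_t⟩` along the computation. -/
def evolved (ξ : Config C.inputs → ℂ) : ℕ → Config (CompQubit N R) → ℂ
  | 0 => C.initState ξ
  | t + 1 => C.U (t + 1) *ᵥ evolved ξ t

/-- The output qubit: the rightmost qubit of the last row. -/
def qout (N R : ℕ) [NeZero N] [NeZero R] : CompQubit N R :=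
  (Fin.ofNat R (R - 1), Fin.ofNat N (N - 1))

/-- The probability that measuring the output qubit after the computation yields `1`. -/
def acceptProb (ξ : Config C.inputs → ℂ) : ℝ :=
  ∑ x, if x (qout N R) = 1 then ‖C.evolved ξ (numSteps N R) x‖ ^ 2 else 0

/-- The time `t_q` of the earliest action of the cursor on the qubit `q`. -/
def firstTime (q : CompQubit N R) : ℕ :=
  sInf {t | 1 ≤ t ∧ t ≤ numSteps N R ∧ q ∈ C.stepQubits (step N R t)}

/-! ### The clock -/

/-- The value of the clock bit `c_i`, for `1 ≤ i ≤ T`, with the boundary conventions `c_0 = 1` and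
`c_{T+1} = 0`. -/
def clockBit {T : ℕ} (z : Config (Fin T)) (i : ℕ) : Fin 2 :=
  if i = 0 then 1 else if h : i - 1 < T then z ⟨i - 1, h⟩ else 0

open Classical in
/-- The operator `|a⟩⟨b|` on the clock qubits `c_{t-1}, c_t, c_{t+1}`, tensored with the identity on
the other clock qubits. At the boundaries, `c_0` (fixed to `1`) and `c_{T+1}` (fixed to `0`) are
omitted, so that for instance `|100⟩⟨100|` means `|00⟩⟨00|` on `c_1, c_2` for `t = 1`, and
`|10⟩⟨10|` on `c_{T-1}, c_T` for `t = T`. -/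
def clockOp (T t : ℕ) (a b : Fin 3 → Fin 2) : QOp (Fin T) :=
  Matrix.of fun z z' =>
    if (∀ k : Fin 3, clockBit z (t - 1 + k) = a k ∧ clockBit z' (t - 1 + k) = b k) ∧
      (∀ s : Fin T, (∀ k : Fin 3, (s : ℕ) + 1 ≠ t - 1 + k) → z s = z' s)
    then 1 else 0

/-- The clock string `1^t 0^{T-t}`. -/
def clockString (T t : ℕ) : Config (Fin T) := fun s => if (s : ℕ) < t then 1 else 0

/-- The history state. -/
def historyState (ξ : Config C.inputs → ℂ) : Config (Qubit N R) → ℂ := fun x =>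
  ((Real.sqrt (1 / ((numSteps N R : ℝ) + 1)) : ℝ) : ℂ) *
    ∑ t ∈ Finset.range (numSteps N R + 1),
      C.evolved ξ t (x ∘ Sum.inl) *
        (if x ∘ Sum.inr = clockString (numSteps N R) t then 1 else 0)

/-! ### The Hamiltonian -/

/-- `|1⟩⟨1|_q ⊗ |100⟩⟨100|` on `c_{t_q-1}, c_{t_q}, c_{t_q+1}`. -/
def inTerm (q : CompQubit N R) : QOp (Qubit N R) :=
  tensorOp (bitProj q 1) (clockOp (numSteps N R) (C.firstTime q) ![1, 0, 0] ![1, 0, 0])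

/-- `|0⟩⟨0|_{q_out} ⊗ |1⟩⟨1|_{c_T}`. -/
def outTerm (N R : ℕ) [NeZero N] [NeZero R] : QOp (Qubit N R) :=
  tensorOp (bitProj (qout N R) 0)
    (Matrix.diagonal fun z => if clockBit z (numSteps N R) = 1 then 1 else 0)

/-- `|01⟩⟨01|` on `c_t, c_{t+1}`. -/
def clockTerm (N R : ℕ) (t : ℕ) : QOp (Qubit N R) :=
  tensorOp 1 (Matrix.diagonal fun z => if clockBit z t = 0 ∧ clockBit z (t + 1) = 1 then 1 else 0)

/-- `H_evolv(t)`. -/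
def evolvTerm (t : ℕ) : QOp (Qubit N R) :=
  tensorOp 1 (clockOp (numSteps N R) t ![1, 0, 0] ![1, 0, 0])
    + tensorOp 1 (clockOp (numSteps N R) t ![1, 1, 0] ![1, 1, 0])
    - tensorOp (C.U t) (clockOp (numSteps N R) t ![1, 1, 0] ![1, 0, 0])
    - tensorOp (C.U t)ᴴ (clockOp (numSteps N R) t ![1, 0, 0] ![1, 1, 0])

open Classical in
/-- `H_in`. -/
def Hin : QOp (Qubit N R) := ∑ q : {q // q ∉ C.Qin}, C.inTerm q

/-- `H_clock`, the sum over `1 ≤ t ≤ T - 1`. -/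
def Hclock (N R : ℕ) : QOp (Qubit N R) := ∑ s : Fin (numSteps N R - 1), clockTerm N R (s + 1)

/-- The Hamiltonian `H_in + H_out + H_clock + (1/2) ∑_{t=1}^T H_evolv(t)`. -/
def hamiltonian : QOp (Qubit N R) :=
  C.Hin + outTerm N R + Hclock N R
    + (1 / 2 : ℂ) • ∑ s : Fin (numSteps N R), C.evolvTerm (s + 1)

/-- Labels of the terms of `H_in`, `H_out`, `H_clock` and `∑ H_evolv(t)`. -/
abbrev TermIdx := {q // q ∉ C.Qin} ⊕ Unit ⊕ Fin (numSteps N R - 1) ⊕ Fin (numSteps N R)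

/-- The individual terms of the Hamiltonian. -/
def term : C.TermIdx → QOp (Qubit N R)
  | .inl q => C.inTerm q
  | .inr (.inl _) => outTerm N R
  | .inr (.inr (.inl s)) => clockTerm N R (s + 1)
  | .inr (.inr (.inr s)) => (1 / 2 : ℂ) • C.evolvTerm (s + 1)

open Classical in
theorem hamiltonian_eq_sum_term : C.hamiltonian = ∑ i, C.term i := by
  simp [hamiltonian, Hin, Hclock, term, Fintype.sum_sum_type, Finset.smul_sum, add_assoc]

/-- The interaction hypergraph: one hyperedge for every term of the Hamiltonian, consisting of the
qubits on which the term acts nontrivially. -/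
def hyperedge (i : C.TermIdx) : Set (Qubit N R) := opSupport (C.term i)

end VerifierCircuit

end

/-!
A vector on the whole register is a family of slices, one for each clock string. The slices at the
strings other than the `1^t 0^(T-t)` cost energy at least `1` each, through `Hclock`. For the slice
`v_t` at `1^t 0^(T-t)`, undoing the first `t` gates gives `φ_t = (U_t ⋯ U_1)ᴴ v_t`, and
`H_evolv(t)` then has energy `‖φ_t - φ_(t-1)‖²`; by Cauchy–Schwarz, `‖φ_s - φ_t‖²` is at most `T`
times the total of these. Since no step before `t_q` acts on `q`, the term of `H_in` at `q` measures
the weight of `q = 1` in `φ_(t_q - 1)` as if it were the initial state, and `H_out` measures the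
rejection of `V φ_T`. Hence every `φ_s` is, up to the energy, both close to the span of the valid
inputs and accepted by the circuit; if all valid inputs are accepted with probability less than `ε`,
this is impossible with margin `1 - ε - √ε`, where the cross term between the two components of
`φ_s` is responsible for `√ε`. Summing over the `T + 1` clock strings loses a factor `O(T³)`.
On the history state only `H_out` has energy, and this energy is the rejection probability divided
by `T + 1`.

For the sparsity, the clock qubits are drawn next to the path of the cursor, so that every term acts
within bounded distance of a lattice point which, together with the kind of the term, determines it.
-/

noncomputable section

/-! ### Squared norms, energies and measurement weights -/

section Energy

variable {ι : Type*} [Fintype ι]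

/-- The squared Euclidean norm of a vector of amplitudes; the function space itself carries the
sup norm. -/
def sqNorm (v : ι → ℂ) : ℝ := ∑ x, ‖v x‖ ^ 2

/-- The expectation value `⟨v|A|v⟩`. -/
def energy (A : Matrix ι ι ℂ) (v : ι → ℂ) : ℝ := (star v ⬝ᵥ (A *ᵥ v)).re

/-- The unnormalized probability that measuring `v` in the standard basis yields an element
of `s`. -/
def weight (s : Set ι) (v : ι → ℂ) : ℝ := sqNorm (s.indicator v)

theorem sqNorm_nonneg (v : ι → ℂ) : 0 ≤ sqNorm v :=
  Finset.sum_nonneg fun _ _ => sq_nonneg _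

theorem sqNorm_zero : sqNorm (0 : ι → ℂ) = 0 := by simp [sqNorm]

theorem sqNorm_eq_norm_sq (v : ι → ℂ) : sqNorm v = ‖WithLp.toLp 2 v‖ ^ 2 := by
  simp [sqNorm, EuclideanSpace.norm_sq_eq]

theorem sqNorm_eq_dotProduct (v : ι → ℂ) : sqNorm v = (star v ⬝ᵥ v).re := by
  simp [sqNorm, dotProduct, ← Complex.normSq_eq_norm_sq, Complex.normSq_apply]

theorem sqNorm_smul (a : ℂ) (v : ι → ℂ) : sqNorm (a • v) = ‖a‖ ^ 2 * sqNorm v := by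
  simp [sqNorm, mul_pow, Finset.mul_sum]

theorem sqNorm_pos {v : ι → ℂ} (hv : v ≠ 0) : 0 < sqNorm v := by
  rw [sqNorm_eq_norm_sq]
  have : WithLp.toLp 2 v ≠ 0 := by simpa using hv
  positivity

theorem sqNorm_add_le (v w : ι → ℂ) : sqNorm (v + w) ≤ (√(sqNorm v) + √(sqNorm w)) ^ 2 := by
  simp only [sqNorm_eq_norm_sq, Real.sqrt_sq (norm_nonneg _), WithLp.toLp_add]
  gcongr
  exact norm_add_le _ _

theorem sqNorm_mulVec_of_unitary [DecidableEq ι] {A : Matrix ι ι ℂ} (hA : Aᴴ * A = 1)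
    (v : ι → ℂ) : sqNorm (A *ᵥ v) = sqNorm v := by
  rw [sqNorm_eq_dotProduct, sqNorm_eq_dotProduct, Matrix.star_mulVec, Matrix.dotProduct_mulVec,
    Matrix.vecMul_vecMul, hA, Matrix.vecMul_one]

theorem norm_sub_le_sum_range {E : Type*} [SeminormedAddCommGroup E] (φ : ℕ → E) {T s t : ℕ}
    (hs : s ≤ T) (ht : t ≤ T) : ‖φ s - φ t‖ ≤ ∑ i ∈ Finset.range T, ‖φ (i + 1) - φ i‖ := by
  wlog hst : t ≤ s generalizing s t
  · rw [norm_sub_rev]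
    exact this ht hs (le_of_not_ge hst)
  rw [← Finset.sum_Ico_sub φ hst]
  refine (norm_sum_le _ _).trans
    (Finset.sum_le_sum_of_subset_of_nonneg ?_ fun _ _ _ => norm_nonneg _)
  rw [Finset.range_eq_Ico]
  exact Finset.Ico_subset_Ico (Nat.zero_le _) hs

theorem sqNorm_sub_le_sum_range (φ : ℕ → ι → ℂ) {T s t : ℕ} (hs : s ≤ T) (ht : t ≤ T) :
    sqNorm (φ s - φ t) ≤ T * ∑ i ∈ Finset.range T, sqNorm (φ (i + 1) - φ i) := by
  simp only [sqNorm_eq_norm_sq, WithLp.toLp_sub]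
  calc ‖WithLp.toLp 2 (φ s) - WithLp.toLp 2 (φ t)‖ ^ 2
      ≤ (∑ i ∈ Finset.range T, ‖WithLp.toLp 2 (φ (i + 1)) - WithLp.toLp 2 (φ i)‖) ^ 2 := by
        gcongr
        exact norm_sub_le_sum_range (fun i => WithLp.toLp 2 (φ i)) hs ht
    _ ≤ T * ∑ i ∈ Finset.range T, ‖WithLp.toLp 2 (φ (i + 1)) - WithLp.toLp 2 (φ i)‖ ^ 2 := by
        simpa only [Finset.card_range] using sq_sum_le_card_mul_sum_sq (s := Finset.range T)
          (f := fun i => ‖WithLp.toLp 2 (φ (i + 1)) - WithLp.toLp 2 (φ i)‖)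

theorem energy_one [DecidableEq ι] (v : ι → ℂ) : energy 1 v = sqNorm v := by
  rw [energy, Matrix.one_mulVec, sqNorm_eq_dotProduct]

theorem energy_add (A B : Matrix ι ι ℂ) (v : ι → ℂ) :
    energy (A + B) v = energy A v + energy B v := by
  simp [energy, Matrix.add_mulVec]

theorem energy_sum {κ : Type*} (s : Finset κ) (A : κ → Matrix ι ι ℂ) (v : ι → ℂ) :
    energy (∑ i ∈ s, A i) v = ∑ i ∈ s, energy (A i) v := by
  simp [energy, Matrix.sum_mulVec, dotProduct_sum]

theorem energy_ofReal_smul (a : ℝ) (A : Matrix ι ι ℂ) (v : ι → ℂ) :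
    energy ((a : ℂ) • A) v = a * energy A v := by
  simp [energy, Matrix.smul_mulVec]

theorem energy_conjTranspose_mul_self (B : Matrix ι ι ℂ) (v : ι → ℂ) :
    energy (Bᴴ * B) v = sqNorm (B *ᵥ v) := by
  rw [energy, sqNorm_eq_dotProduct, Matrix.star_mulVec, ← Matrix.mulVec_mulVec,
    Matrix.dotProduct_mulVec]

theorem energy_of_hasEigenvector [DecidableEq ι] {A : Matrix ι ι ℂ} {μ : ℝ} {v : ι → ℂ}
    (h : Module.End.HasEigenvector (Matrix.toLin' A) (μ : ℂ) v) :
    energy A v = μ * sqNorm v := by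
  have hAv : A *ᵥ v = (μ : ℂ) • v := h.apply_eq_smul
  rw [energy, hAv, sqNorm_eq_dotProduct, dotProduct_smul, smul_eq_mul, Complex.re_ofReal_mul]

open Classical in
theorem weight_eq_sum (s : Set ι) (v : ι → ℂ) :
    weight s v = ∑ x, if x ∈ s then ‖v x‖ ^ 2 else 0 := by
  refine Finset.sum_congr rfl fun x _ => ?_
  by_cases hx : x ∈ s <;> simp [hx]

theorem weight_nonneg (s : Set ι) (v : ι → ℂ) : 0 ≤ weight s v := sqNorm_nonneg _

theorem weight_zero (s : Set ι) : weight s (0 : ι → ℂ) = 0 := by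
  rw [weight, Set.indicator_zero', sqNorm_zero]

theorem weight_smul (s : Set ι) (a : ℂ) (v : ι → ℂ) :
    weight s (a • v) = ‖a‖ ^ 2 * weight s v :=
  (congrArg sqNorm (Set.indicator_const_smul s a v)).trans (sqNorm_smul _ _)

theorem weight_add_weight_compl (s : Set ι) (v : ι → ℂ) :
    weight s v + weight sᶜ v = sqNorm v := by
  classical
  rw [weight_eq_sum, weight_eq_sum, sqNorm, ← Finset.sum_add_distrib]
  refine Finset.sum_congr rfl fun x _ => ?_
  by_cases hx : x ∈ s <;> simp [hx]

theorem weight_le_sqNorm (s : Set ι) (v : ι → ℂ) : weight s v ≤ sqNorm v := by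
  linarith [weight_add_weight_compl s v, weight_nonneg sᶜ v]

theorem weight_iUnion_le {κ : Type*} [Fintype κ] (s : κ → Set ι) (v : ι → ℂ) :
    weight (⋃ k, s k) v ≤ ∑ k, weight (s k) v := by
  classical
  simp only [weight_eq_sum]
  rw [Finset.sum_comm]
  refine Finset.sum_le_sum fun x _ => ?_
  split_ifs with hx
  · obtain ⟨k, hk⟩ := Set.mem_iUnion.1 hx
    refine le_trans ?_ (Finset.single_le_sum (fun k _ => ?_) (Finset.mem_univ k))
    · rw [if_pos hk]
    · positivity
  · positivity

theorem weight_add_le (s : Set ι) (v w : ι → ℂ) :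
    weight s (v + w) ≤ (√(weight s v) + √(weight s w)) ^ 2 := by
  rw [weight, Set.indicator_add']
  exact sqNorm_add_le _ _

theorem weight_le_two_mul (s : Set ι) (v w : ι → ℂ) :
    weight s v ≤ 2 * weight s w + 2 * sqNorm (v - w) := by
  have h := weight_add_le s w (v - w)
  rw [add_sub_cancel] at h
  nlinarith [sq_nonneg (√(weight s w) - √(weight s (v - w))), Real.sq_sqrt (weight_nonneg s w),
    Real.sq_sqrt (weight_nonneg s (v - w)), weight_le_sqNorm s (v - w)]

/-! ### From rejection of all inputs to an energy gap -/

theorem mul_sqNorm_le_weight_compl_add_weight_compl [DecidableEq ι] {V : Matrix ι ι ℂ}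
    (hV : Vᴴ * V = 1) {S A : Set ι} {ε : ℝ} (hε : 0 ≤ ε)
    (h : ∀ α : ι → ℂ, Function.support α ⊆ S → weight A (V *ᵥ α) ≤ ε * sqNorm α) (χ : ι → ℂ) :
    (1 - ε - √ε) * sqNorm χ ≤ weight Sᶜ χ + weight Aᶜ (V *ᵥ χ) := by
  set α := S.indicator χ
  set β := Sᶜ.indicator χ
  have hα := sqNorm_nonneg α
  have hβ := sqNorm_nonneg β
  have hχ : sqNorm α + sqNorm β = sqNorm χ := weight_add_weight_compl S χ
  have hA : weight A (V *ᵥ χ) ≤ (√ε * √(sqNorm α) + √(sqNorm β)) ^ 2 := by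
    rw [← Set.indicator_self_add_compl S χ, Matrix.mulVec_add, ← Real.sqrt_mul hε]
    refine (weight_add_le _ _ _).trans ?_
    gcongr
    · exact h α Set.support_indicator_subset
    · exact (weight_le_sqNorm _ _).trans_eq (sqNorm_mulVec_of_unitary hV β)
  have hsq : (√ε * √(sqNorm α) + √(sqNorm β)) ^ 2
      = ε * sqNorm α + √ε * (2 * √(sqNorm α) * √(sqNorm β)) + sqNorm β := by
    rw [add_sq, mul_pow, Real.sq_sqrt hε, Real.sq_sqrt hα, Real.sq_sqrt hβ]
    ring
  have hcross : √ε * (2 * √(sqNorm α) * √(sqNorm β)) ≤ √ε * (sqNorm α + sqNorm β) := by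
    gcongr
    simpa only [Real.sq_sqrt hα, Real.sq_sqrt hβ] using
      two_mul_le_add_sq (√(sqNorm α)) (√(sqNorm β))
  have hAc := weight_add_weight_compl A (V *ᵥ χ)
  rw [sqNorm_mulVec_of_unitary hV] at hAc
  change _ ≤ sqNorm β + _
  rw [← hχ] at hAc ⊢
  linarith [mul_nonneg hε hβ]

theorem mul_sqNorm_le_of_path [DecidableEq ι] {κ : Type*} [Fintype κ] {V : Matrix ι ι ℂ}
    (hV : Vᴴ * V = 1) {B : κ → Set ι} {J : Set ι} {δ : ℝ}
    (h : ∀ χ, δ * sqNorm χ ≤ weight (⋃ k, B k) χ + weight J (V *ᵥ χ))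
    (φ : ℕ → ι → ℂ) {T : ℕ} {τ : κ → ℕ} (hτ : ∀ k, τ k ≤ T) {s : ℕ} (hs : s ≤ T) :
    δ * sqNorm (φ s) ≤ 2 * ∑ k, weight (B k) (φ (τ k)) + 2 * weight J (V *ᵥ φ T)
      + 2 * (Fintype.card κ + 1) * (T * ∑ i ∈ Finset.range T, sqNorm (φ (i + 1) - φ i)) := by
  set D := T * ∑ i ∈ Finset.range T, sqNorm (φ (i + 1) - φ i)
  have hB (k : κ) : weight (B k) (φ s) ≤ 2 * weight (B k) (φ (τ k)) + 2 * D :=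
    (weight_le_two_mul _ _ _).trans (by gcongr; exact sqNorm_sub_le_sum_range φ hs (hτ k))
  have hJ : weight J (V *ᵥ φ s) ≤ 2 * weight J (V *ᵥ φ T) + 2 * D := by
    refine (weight_le_two_mul _ _ (V *ᵥ φ T)).trans ?_
    rw [← Matrix.mulVec_sub, sqNorm_mulVec_of_unitary hV]
    gcongr
    exact sqNorm_sub_le_sum_range φ hs le_rfl
  calc δ * sqNorm (φ s)
      ≤ ∑ k, weight (B k) (φ s) + weight J (V *ᵥ φ s) :=
        (h _).trans (by gcongr; exact weight_iUnion_le _ _)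
    _ ≤ ∑ k, (2 * weight (B k) (φ (τ k)) + 2 * D) + (2 * weight J (V *ᵥ φ T) + 2 * D) := by
        gcongr with k
        exact hB k
    _ = _ := by
        rw [Finset.sum_add_distrib, ← Finset.mul_sum, Finset.sum_const, Finset.card_univ,
          nsmul_eq_mul]
        ring

end Energy

/-! ### Operators on registers -/

section Operators

variable {V W : Type*}

theorem tensorOp_apply (A : QOp V) (B : QOp W) (x y : Config (V ⊕ W)) :
    tensorOp A B x y = A (x ∘ Sum.inl) (y ∘ Sum.inl) * B (x ∘ Sum.inr) (y ∘ Sum.inr) := rfl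

theorem tensorOp_conjTranspose (A : QOp V) (B : QOp W) :
    (tensorOp A B)ᴴ = tensorOp Aᴴ Bᴴ := by
  ext x y
  simp [tensorOp_apply, Matrix.conjTranspose_apply]

open scoped ComplexOrder in
theorem tensorOp_posSemidef [Finite V] [Finite W] {A : QOp V} {B : QOp W} (hA : A.PosSemidef)
    (hB : B.PosSemidef) : (tensorOp A B).PosSemidef :=
  (hA.kronecker hB).submatrix _

/-- The splitting of a register into the qubits `f 0, …, f (k - 1)` and the others. -/
def configSplit {k : ℕ} (f : Fin k ↪ V) :
    Config V ≃ Config (Fin k) × Config {v // v ∉ Set.range f} := by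
  classical
  exact ((((Equiv.ofInjective f f.injective).sumCongr (Equiv.refl _)).trans
    (Equiv.Set.sumCompl (Set.range f))).arrowCongr (Equiv.refl _)).symm.trans
    (Equiv.sumArrowEquivProdArrow _ _ _)

theorem configSplit_fst {k : ℕ} (f : Fin k ↪ V) (x : Config V) : (configSplit f x).1 = x ∘ f := by
  ext i
  simp [configSplit, Equiv.sumArrowEquivProdArrow]

theorem configSplit_snd {k : ℕ} (f : Fin k ↪ V) (x : Config V) (v : {v // v ∉ Set.range f}) :
    (configSplit f x).2 v = x v := rfl

open Classical in
theorem onQubits_eq_submatrix {k : ℕ} (f : Fin k ↪ V) (A : QOp (Fin k)) :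
    onQubits f A = (A ⊗ₖ (1 : QOp {v // v ∉ Set.range f})).submatrix
      (configSplit f) (configSplit f) := by
  ext x y
  have h : (configSplit f x).2 = (configSplit f y).2 ↔ ∀ v, v ∉ Set.range f → x v = y v := by
    simp only [funext_iff, configSplit_snd, Subtype.forall]
  simp only [onQubits, Matrix.of_apply, Matrix.submatrix_apply, Matrix.kroneckerMap_apply,
    Matrix.one_apply, h, configSplit_fst, mul_ite, mul_one, mul_zero]

variable [Fintype V] [DecidableEq V]

theorem onQubits_unitary {k : ℕ} (f : Fin k ↪ V) {A : QOp (Fin k)} (hA : Aᴴ * A = 1) :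
    (onQubits f A)ᴴ * onQubits f A = 1 := by
  classical
  rw [onQubits_eq_submatrix, Matrix.conjTranspose_submatrix, Matrix.submatrix_mul_equiv,
    Matrix.conjTranspose_kronecker, ← Matrix.mul_kronecker_mul, hA]
  simp

theorem swapOp_unitary (q q' : V) : (swapOp q q')ᴴ * swapOp q q' = 1 := by
  have hinv : Function.Involutive fun x : Config V => x ∘ Equiv.swap q q' := fun x => by
    ext v; simp
  ext x y
  simp only [Matrix.mul_apply, Matrix.conjTranspose_apply, swapOp, Matrix.of_apply,
    Matrix.one_apply]
  rw [Finset.sum_eq_single (x ∘ Equiv.swap q q')]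
  · simp [hinv.injective.eq_iff]
  · intro z _ hz
    simp [hz]
  · simp

theorem energy_bitProj (q : V) (b : Fin 2) (φ : Config V → ℂ) :
    energy (bitProj q b) φ = weight {x | x q = b} φ := by
  have h : bitProj q b *ᵥ φ = {x | x q = b}.indicator φ := by
    ext x
    simp [bitProj, Matrix.mulVec_diagonal, Set.indicator_apply]
  rw [energy, h, weight, sqNorm_eq_dotProduct]
  congr 1
  refine Finset.sum_congr rfl fun x _ => ?_
  by_cases hx : x q = b <;> simp [hx]

variable [Fintype W] [DecidableEq W]

theorem sum_config_sum {M : Type*} [AddCommMonoid M] (F : Config (V ⊕ W) → M) :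
    ∑ x, F x = ∑ z : Config W, ∑ x : Config V, F (Sum.elim x z) := by
  rw [← Fintype.sum_prod_type_right', ← (Equiv.sumArrowEquivProdArrow V W (Fin 2)).symm.sum_comp]
  rfl

theorem tensorOp_mul (A A' : QOp V) (B B' : QOp W) :
    tensorOp A B * tensorOp A' B' = tensorOp (A * A') (B * B') := by
  rw [tensorOp, tensorOp, tensorOp, Matrix.submatrix_mul_equiv, ← Matrix.mul_kronecker_mul]

/-- The component of a state of two registers at the configuration `z` of the second one. -/
def slice {V W : Type*} (v : Config (V ⊕ W) → ℂ) (z : Config W) : Config V → ℂ :=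
  fun x => v (Sum.elim x z)

theorem sqNorm_eq_sum_slice (v : Config (V ⊕ W) → ℂ) : sqNorm v = ∑ z, sqNorm (slice v z) :=
  sum_config_sum _

theorem slice_tensorOp_mulVec (A : QOp V) (B : QOp W) (v : Config (V ⊕ W) → ℂ) (z : Config W) :
    slice (tensorOp A B *ᵥ v) z = ∑ z', B z z' • (A *ᵥ slice v z') := by
  ext x
  simp only [slice, Matrix.mulVec, dotProduct, sum_config_sum, tensorOp_apply, Sum.elim_comp_inl,
    Sum.elim_comp_inr, Finset.sum_apply, Pi.smul_apply, smul_eq_mul, Finset.mul_sum]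
  exact Finset.sum_congr rfl fun _ _ => Finset.sum_congr rfl fun _ _ => by ring

theorem energy_tensorOp_diagonal (A : QOp V) (p : Config W → Prop) [DecidablePred p]
    (v : Config (V ⊕ W) → ℂ) :
    energy (tensorOp A (Matrix.diagonal fun z => if p z then 1 else 0)) v
      = ∑ z, if p z then energy A (slice v z) else 0 := by
  have hslice (z : Config W) :
      slice (tensorOp A (Matrix.diagonal fun z => if p z then 1 else 0) *ᵥ v) z
        = if p z then A *ᵥ slice v z else 0 := by
    rw [slice_tensorOp_mulVec, Finset.sum_eq_single_of_mem z (Finset.mem_univ z)]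
    · rw [Matrix.diagonal_apply_eq, ite_smul, one_smul, zero_smul]
    · intro z' _ hz'
      rw [Matrix.diagonal_apply_ne _ hz'.symm, zero_smul]
  calc energy (tensorOp A (Matrix.diagonal fun z => if p z then 1 else 0)) v
      = ∑ z, (star (slice v z) ⬝ᵥ slice (tensorOp A (Matrix.diagonal fun z =>
          if p z then 1 else 0) *ᵥ v) z).re := by
        rw [energy, dotProduct, sum_config_sum, Complex.re_sum]
        rfl
    _ = _ := by
        refine Finset.sum_congr rfl fun z _ => ?_
        rw [hslice]
        split_ifs
        · rfl
        · rw [dotProduct_zero, Complex.zero_re]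

end Operators

/-! ### Locality -/

section Locality

variable {V W : Type*} [DecidableEq V] [DecidableEq W]

theorem opSupport_subset_iff {A : QOp V} {s : Set V} :
    opSupport A ⊆ s ↔ ∀ v ∉ s, ActsTriviallyOn A v :=
  ⟨fun h _ hv => by_contra fun hA => hv (h hA), fun h _ hv => by_contra fun hs => hv (h _ hs)⟩

theorem ActsTriviallyOn.add {A B : QOp V} {v : V} (hA : ActsTriviallyOn A v)
    (hB : ActsTriviallyOn B v) : ActsTriviallyOn (A + B) v := fun x y => by
  rw [Matrix.add_apply, Matrix.add_apply, hA x y, hB x y, ite_add_ite, add_zero]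

theorem ActsTriviallyOn.smul {A : QOp V} {v : V} (hA : ActsTriviallyOn A v) (a : ℂ) :
    ActsTriviallyOn (a • A) v := fun x y => by
  rw [Matrix.smul_apply, Matrix.smul_apply, hA x y, smul_ite, smul_zero]

theorem ActsTriviallyOn.sub {A B : QOp V} {v : V} (hA : ActsTriviallyOn A v)
    (hB : ActsTriviallyOn B v) : ActsTriviallyOn (A - B) v := by
  rw [sub_eq_add_neg, ← neg_one_smul ℂ B]
  exact hA.add (hB.smul _)

theorem ActsTriviallyOn.conjTranspose {A : QOp V} {v : V} (hA : ActsTriviallyOn A v) :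
    ActsTriviallyOn Aᴴ v := fun x y => by
  rw [Matrix.conjTranspose_apply, Matrix.conjTranspose_apply, hA y x, apply_ite star, star_zero]
  exact if_congr eq_comm rfl rfl

theorem ActsTriviallyOn.tensorOp_inl {A : QOp V} {v : V} (hA : ActsTriviallyOn A v)
    (B : QOp W) : ActsTriviallyOn (tensorOp A B) (Sum.inl v) := by
  intro x y
  simp only [tensorOp_apply]
  rw [hA]
  simp only [Function.comp_apply, ite_mul, zero_mul, Sum.update_inl_comp_inl,
    Sum.update_inl_comp_inr]

theorem ActsTriviallyOn.tensorOp_inr {B : QOp W} {w : W} (hB : ActsTriviallyOn B w)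
    (A : QOp V) : ActsTriviallyOn (tensorOp A B) (Sum.inr w) := by
  intro x y
  simp only [tensorOp_apply]
  rw [hB]
  simp only [Function.comp_apply, mul_ite, mul_zero, Sum.update_inr_comp_inl,
    Sum.update_inr_comp_inr]

theorem opSupport_tensorOp_subset (A : QOp V) (B : QOp W) :
    opSupport (tensorOp A B) ⊆ Sum.inl '' opSupport A ∪ Sum.inr '' opSupport B := by
  rintro (v | w) h
  · exact .inl ⟨v, fun hA => h (hA.tensorOp_inl B), rfl⟩
  · exact .inr ⟨w, fun hB => h (hB.tensorOp_inr A), rfl⟩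

theorem eq_iff_update_eq_update {v : V} {x y : Config V} (h : x v = y v) :
    x = y ↔ Function.update x v 0 = Function.update y v 0 := by
  refine ⟨fun h => by rw [h], fun h' => funext fun w => ?_⟩
  by_cases hw : w = v
  · rw [hw, h]
  · simpa [hw] using congrFun h' w

theorem actsTriviallyOn_onQubits {k : ℕ} {f : Fin k ↪ V} {v : V} (hv : v ∉ Set.range f)
    (A : QOp (Fin k)) : ActsTriviallyOn (onQubits f A) v := by
  classical
  intro x y
  have hf (x : Config V) : Function.update x v 0 ∘ f = x ∘ f :=
    Function.update_comp_eq_of_notMem_range x 0 hv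
  by_cases hxy : x v = y v
  · rw [if_pos hxy]
    simp only [onQubits, Matrix.of_apply, hf]
    refine if_congr (forall_congr' fun w => ?_) rfl rfl
    by_cases hw : w = v
    · simp [hw, hxy]
    · simp [hw]
  · rw [if_neg hxy]
    exact if_neg fun h => hxy (h v hv)

variable [Fintype V]

theorem actsTriviallyOn_diagonal {d : Config V → ℂ} {v : V}
    (h : ∀ x, d (Function.update x v 0) = d x) : ActsTriviallyOn (Matrix.diagonal d) v := by
  intro x y
  by_cases hxy : x v = y v
  · rw [if_pos hxy, Matrix.diagonal_apply, Matrix.diagonal_apply, h]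
    exact if_congr (eq_iff_update_eq_update hxy) rfl rfl
  · rw [if_neg hxy, Matrix.diagonal_apply_ne]
    exact fun h => hxy (by rw [h])

theorem actsTriviallyOn_one (v : V) : ActsTriviallyOn (1 : QOp V) v :=
  actsTriviallyOn_diagonal fun _ => rfl

theorem opSupport_bitProj_subset (q : V) (b : Fin 2) : opSupport (bitProj q b) ⊆ {q} :=
  opSupport_subset_iff.2 fun v hv => actsTriviallyOn_diagonal fun x => by
    rw [Function.update_of_ne (show q ≠ v from Ne.symm hv)]

theorem actsTriviallyOn_swapOp {q q' v : V} (hq : v ≠ q) (hq' : v ≠ q') :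
    ActsTriviallyOn (swapOp q q') v := by
  have hv : Equiv.swap q q' v = v := Equiv.swap_apply_of_ne_of_ne hq hq'
  have hu (y : Config V) : Function.update y v 0 ∘ Equiv.swap q q'
      = Function.update (y ∘ Equiv.swap q q') v 0 := by
    conv_lhs => rw [← hv]
    exact Function.update_comp_eq_of_injective y (Equiv.swap q q').injective v 0
  intro x y
  have hy : (y ∘ Equiv.swap q q') v = y v := congrArg y hv
  simp only [swapOp, Matrix.of_apply, hu]
  by_cases hxy : x v = y v
  · rw [if_pos hxy]
    exact if_congr (eq_iff_update_eq_update (hxy.trans hy.symm)) rfl rfl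
  · rw [if_neg hxy, if_neg]
    rintro rfl
    exact hxy hy

theorem ActsTriviallyOn.mulVec_indicator {A : QOp V} {v : V} (hA : ActsTriviallyOn A v)
    (b : Fin 2) (φ : Config V → ℂ) :
    A *ᵥ {x | x v = b}.indicator φ = {x | x v = b}.indicator (A *ᵥ φ) := by
  ext x
  have h (y : Config V) : A x y * {x | x v = b}.indicator φ y
      = if x v = b then A x y * φ y else 0 := by
    by_cases hxy : x v = y v
    · simp [hxy, Set.indicator_apply]
    · simp [hA x y, hxy]
  rw [Matrix.mulVec, dotProduct, Finset.sum_congr rfl fun y _ => h y]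
  by_cases hx : x v = b
  · simp [hx, Matrix.mulVec, dotProduct]
  · simp [hx]

end Locality

namespace VerifierCircuit

/-! ### The clock -/

section Clock

variable {T : ℕ}

theorem clockBit_zero (z : Config (Fin T)) : clockBit z 0 = 1 := if_pos rfl

theorem clockBit_succ (z : Config (Fin T)) (s : Fin T) : clockBit z (s + 1) = z s := by
  simp [clockBit]

theorem clockBit_of_gt (z : Config (Fin T)) {i : ℕ} (h : T < i) : clockBit z i = 0 := by
  rw [clockBit, if_neg (by lia), dif_neg (by lia)]

theorem clockBit_update (z : Config (Fin T)) {s : Fin T} {i : ℕ} (h : i ≠ s + 1) (b : Fin 2) :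
    clockBit (Function.update z s b) i = clockBit z i := by
  unfold clockBit
  split_ifs with h0 hT
  · rfl
  · exact Function.update_of_ne (fun hs => h (by rw [← hs]; simp only; lia)) _ _
  · rfl

theorem clockBit_clockString {t : ℕ} (ht : t ≤ T) (i : ℕ) :
    clockBit (clockString T t) i = if i ≤ t then 1 else 0 := by
  unfold clockBit clockString
  grind

theorem clockString_injOn : Set.InjOn (clockString T) (Finset.range (T + 1)) := by
  have hle {t t' : ℕ} (ht : t ≤ T) (ht' : t' ≤ T) (h : clockString T t = clockString T t') :
      t ≤ t' := by
    by_contra hlt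
    have hbit := congrArg (clockBit · t) h
    simp [clockBit_clockString ht, clockBit_clockString ht', hlt] at hbit
  intro t ht t' ht' h
  rw [Finset.mem_coe, Finset.mem_range_succ_iff] at ht ht'
  exact (hle ht ht' h).antisymm (hle ht' ht h.symm)

/-- The clock strings `1^t 0^{T-t}` for `0 ≤ t ≤ T`. -/
def validClocks (T : ℕ) : Finset (Config (Fin T)) :=
  (Finset.range (T + 1)).image (clockString T)

theorem mem_validClocks {z : Config (Fin T)} :
    z ∈ validClocks T ↔ ∃ t ≤ T, clockString T t = z := by
  simp [validClocks]

theorem sum_validClocks {M : Type*} [AddCommMonoid M] (F : Config (Fin T) → M) :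
    ∑ z ∈ validClocks T, F z = ∑ t ∈ Finset.range (T + 1), F (clockString T t) :=
  Finset.sum_image clockString_injOn

theorem mem_validClocks_of_antitone {z : Config (Fin T)} (hz : Antitone (clockBit z)) :
    z ∈ validClocks T := by
  have hex : ∃ i, clockBit z (i + 1) = 0 := ⟨T, clockBit_of_gt z (Nat.lt_succ_self T)⟩
  have ht : Nat.find hex ≤ T := Nat.find_min' hex (clockBit_of_gt z (Nat.lt_succ_self T))
  refine mem_validClocks.2 ⟨Nat.find hex, ht, funext fun s => ?_⟩
  rw [clockString]
  split_ifs with hs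
  · exact (Fin.eq_one_of_ne_zero _ fun h => Nat.find_min hex hs (by rwa [clockBit_succ])).symm
  · have hle := hz (show Nat.find hex + 1 ≤ s + 1 by lia)
    rw [Nat.find_spec hex, clockBit_succ] at hle
    exact (Fin.le_zero_iff.1 hle).symm

theorem exists_violation_of_notMem_validClocks {z : Config (Fin T)} (hz : z ∉ validClocks T) :
    ∃ s : Fin (T - 1), clockBit z (s + 1) = 0 ∧ clockBit z (s + 1 + 1) = 1 := by
  contrapose! hz
  refine mem_validClocks_of_antitone (antitone_nat_of_succ_le fun i => ?_)
  rcases Nat.eq_zero_or_pos i with rfl | hi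
  · rw [clockBit_zero]
    exact Fin.le_last _
  rcases Nat.lt_or_ge i T with hiT | hiT
  · by_contra! hlt
    obtain ⟨j, rfl⟩ := Nat.exists_eq_succ_of_ne_zero hi.ne'
    exact hz ⟨j, by lia⟩ (by simp only at *; lia) (by simp only at *; lia)
  · rw [clockBit_of_gt z (Nat.lt_succ_of_le hiT)]
    exact Fin.zero_le _

/-- The clock qubit `s`, that is `c_{s+1}`, lies between a bit `1` and a bit `0`, so that it may
take either value in a clock string. -/
def AtFront (s : Fin T) (z : Config (Fin T)) : Prop :=
  clockBit z s = 1 ∧ clockBit z (s + 2) = 0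

instance (s : Fin T) : DecidablePred (AtFront s) := fun _ => instDecidableAnd

theorem atFront_update (s : Fin T) (z : Config (Fin T)) (b : Fin 2) :
    AtFront s (Function.update z s b) ↔ AtFront s z := by
  rw [AtFront, AtFront, clockBit_update z (by lia), clockBit_update z (by lia)]

theorem atFront_clockString_iff (s : Fin T) {t : ℕ} (ht : t ≤ T) (a : Fin 2) :
    AtFront s (clockString T t) ∧ clockString T t s = a ↔ t = s + a := by
  rw [AtFront, clockBit_clockString ht, clockBit_clockString ht, clockString]
  fin_cases a <;> grind

theorem update_clockString (s : Fin T) (a b : Fin 2) :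
    Function.update (clockString T (s + a)) s b = clockString T (s + b) := by
  ext1 i
  rw [Function.update_apply, clockString, clockString]
  fin_cases a <;> fin_cases b <;> grind

theorem clockOp_apply (s : Fin T) (a b : Fin 2) (z w : Config (Fin T)) :
    clockOp T (s + 1) ![1, a, 0] ![1, b, 0] z w
      = if (AtFront s z ∧ z s = a) ∧ Function.update z s b = w then 1 else 0 := by
  rw [clockOp, Matrix.of_apply]
  refine if_congr ⟨?_, ?_⟩ rfl rfl
  · rintro ⟨hk, hoff⟩
    simp only [Nat.add_sub_cancel] at hk hoff
    refine ⟨⟨⟨(hk 0).1, (hk 2).1⟩, (clockBit_succ z s).symm.trans (hk 1).1⟩, funext fun i => ?_⟩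
    rcases eq_or_ne i s with rfl | hi
    · rw [Function.update_self, ← clockBit_succ w]
      exact (hk 1).2.symm
    · rw [Function.update_of_ne hi]
      by_cases hfar : ∀ k : Fin 3, (i : ℕ) + 1 ≠ s + k
      · exact hoff i hfar
      · push Not at hfar
        obtain ⟨k, hik⟩ := hfar
        rw [← clockBit_succ z, ← clockBit_succ w, hik, (hk k).1, (hk k).2]
        fin_cases k
        · rfl
        · exact absurd (Fin.ext (Nat.succ_injective hik)) hi
        · rfl
  · rintro ⟨⟨⟨h0, h2⟩, rfl⟩, rfl⟩
    refine ⟨fun k => ?_, fun i hi => (Function.update_of_ne ?_ _ _).symm⟩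
    · fin_cases k
      · exact ⟨h0, (clockBit_update z (by simp) b).trans h0⟩
      · exact ⟨clockBit_succ z s, (clockBit_succ _ s).trans (Function.update_self ..)⟩
      · exact ⟨h2, (clockBit_update z (by simp) b).trans h2⟩
    · rintro rfl
      exact hi 1 rfl

theorem clockOp_conjTranspose (t : ℕ) (a b : Fin 3 → Fin 2) :
    (clockOp T t a b)ᴴ = clockOp T t b a := by
  ext z z'
  simp only [clockOp, Matrix.conjTranspose_apply, Matrix.of_apply, apply_ite star, star_one,
    star_zero]
  refine if_congr (and_congr ?_ ?_) rfl rfl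
  · exact forall_congr' fun k => and_comm
  · exact forall_congr' fun s => imp_congr_right fun _ => eq_comm

theorem clockOp_self (s : Fin T) (a : Fin 2) :
    clockOp T (s + 1) ![1, a, 0] ![1, a, 0]
      = Matrix.diagonal fun z => if AtFront s z ∧ z s = a then 1 else 0 := by
  ext z w
  rw [clockOp_apply, Matrix.diagonal_apply, ← ite_and]
  refine if_congr ⟨?_, ?_⟩ rfl rfl
  · rintro ⟨⟨hz, rfl⟩, rfl⟩
    exact ⟨(Function.update_eq_self s z).symm, hz, rfl⟩
  · rintro ⟨rfl, hz, rfl⟩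
    exact ⟨⟨hz, rfl⟩, Function.update_eq_self s z⟩

theorem clockOp_mul (s : Fin T) (a b c : Fin 2) :
    clockOp T (s + 1) ![1, a, 0] ![1, b, 0] * clockOp T (s + 1) ![1, b, 0] ![1, c, 0]
      = clockOp T (s + 1) ![1, a, 0] ![1, c, 0] := by
  ext z w
  rw [Matrix.mul_apply, Finset.sum_eq_single_of_mem (Function.update z s b) (Finset.mem_univ _)]
  · simp only [clockOp_apply, atFront_update, Function.update_self, Function.update_idem,
      and_true, ite_zero_mul_ite_zero, mul_one]
    exact if_congr (by tauto) rfl rfl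
  · intro y _ hy
    rw [clockOp_apply, if_neg fun h => hy h.2.symm, zero_mul]

theorem actsTriviallyOn_clockOp {t : ℕ} {s : Fin T} (h : ∀ k : Fin 3, (s : ℕ) + 1 ≠ t - 1 + k)
    (a b : Fin 3 → Fin 2) : ActsTriviallyOn (clockOp T t a b) s := by
  classical
  intro z z'
  have hb (z : Config (Fin T)) (k : Fin 3) :
      clockBit (Function.update z s 0) (t - 1 + k) = clockBit z (t - 1 + k) :=
    clockBit_update z (h k).symm _
  by_cases hz : z s = z' s
  · rw [if_pos hz]
    simp only [clockOp, Matrix.of_apply, hb]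
    refine if_congr (and_congr_right fun _ => forall_congr' fun i => ?_) rfl rfl
    by_cases hi : i = s
    · simp [hi, hz]
    · simp [hi]
  · rw [if_neg hz]
    exact if_neg fun h' => hz (h'.2 s h)

end Clock

end VerifierCircuit

theorem mul_add_div_of_lt {a b c : ℕ} (h : c < b) : (a * b + c) / b = a := by
  rw [mul_comm, Nat.mul_add_div (by lia), Nat.div_eq_of_lt h, add_zero]

namespace VerifierCircuit

variable {N R : ℕ} (C : VerifierCircuit N R)

/-! ### The circuit -/

theorem stepOp_unitary (st : Step N R) : (C.stepOp st)ᴴ * C.stepOp st = 1 := by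
  classical
  cases st with
  | gate r j =>
    rw [stepOp]
    split_ifs
    · exact onQubits_unitary _ (Matrix.mem_unitaryGroup_iff'.1 (C.gate r).U.2)
    · rw [Matrix.conjTranspose_one, Matrix.one_mul]
  | swap r r' j => exact swapOp_unitary _ _

theorem opSupport_stepOp_subset (st : Step N R) : opSupport (C.stepOp st) ⊆ C.stepQubits st := by
  classical
  refine opSupport_subset_iff.2 fun q hq => ?_
  cases st with
  | gate r j =>
    simp only [stepOp, stepQubits] at hq ⊢
    split_ifs at hq ⊢
    · refine actsTriviallyOn_onQubits ?_ _
      rintro ⟨i, rfl⟩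
      exact hq ⟨_, ⟨i, rfl⟩, rfl⟩
    · exact actsTriviallyOn_one q
    · exact actsTriviallyOn_one q
  | swap r r' j =>
    simp only [stepQubits, Set.mem_insert_iff, Set.mem_singleton_iff, not_or] at hq
    exact actsTriviallyOn_swapOp hq.1 hq.2

theorem gate_time_le (r : Fin R) (j : Fin N) : 2 * (r : ℕ) * N + j + 1 ≤ numSteps N R := by
  have h : (2 * (r : ℕ) + 1) * N ≤ (2 * R - 1) * N := Nat.mul_le_mul_right N (by lia)
  rw [numSteps]
  linarith [j.isLt]

section Input

variable [NeZero R]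

/-- The configurations in which all the qubits outside the input register are `0`. -/
def validInputs : Set (Config (CompQubit N R)) := {x | ∀ q, q ∉ C.Qin → x q = 0}

theorem compl_validInputs : C.validInputsᶜ = ⋃ q : {q // q ∉ C.Qin}, {x | x q = 1} := by
  ext x
  have hbit (b : Fin 2) : ¬ b = 0 ↔ b = 1 := by lia
  simp [validInputs, hbit]

/-- A configuration of the input register, padded by zeros. -/
def padInput (y : Config C.inputs) : Config (CompQubit N R) :=
  fun q => if h : q.1 = 0 ∧ q.2 ∈ C.inputs then y ⟨q.2, h.2⟩ else 0

theorem padInput_mem (y : Config C.inputs) : C.padInput y ∈ C.validInputs :=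
  fun _ hq => dif_neg hq

theorem padInput_comp (y : Config C.inputs) : (fun j : C.inputs => C.padInput y (0, j)) = y := by
  ext j
  simp [padInput]

theorem padInput_eq {x : Config (CompQubit N R)} (hx : x ∈ C.validInputs) :
    C.padInput (fun j => x (0, j)) = x := by
  ext1 q
  by_cases h : q.1 = 0 ∧ q.2 ∈ C.inputs
  · rw [padInput, dif_pos h]
    simp only [← h.1]
  · rw [padInput, dif_neg h, hx q h]

theorem initState_padInput (ξ : Config C.inputs → ℂ) (y : Config C.inputs) :
    C.initState ξ (C.padInput y) = ξ y := by
  rw [initState, if_pos fun q hq => C.padInput_mem y q hq, padInput_comp]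

theorem exists_initState_eq {φ : Config (CompQubit N R) → ℂ}
    (hφ : Function.support φ ⊆ C.validInputs) : ∃ ξ, C.initState ξ = φ := by
  classical
  refine ⟨φ ∘ C.padInput, funext fun x => ?_⟩
  rw [initState]
  split_ifs with h
  · rw [Function.comp_apply, C.padInput_eq h]
  · exact (Function.notMem_support.1 fun hx => h (hφ hx)).symm

theorem initState_apply_of_notMem (ξ : Config C.inputs → ℂ) {x : Config (CompQubit N R)}
    (hx : x ∉ C.validInputs) : C.initState ξ x = 0 := if_neg hx

theorem weight_initState {q : CompQubit N R} (hq : q ∉ C.Qin) (ξ : Config C.inputs → ℂ) :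
    weight {x | x q = 1} (C.initState ξ) = 0 := by
  have hzero : {x : Config (CompQubit N R) | x q = 1}.indicator (C.initState ξ) = 0 :=
    Set.indicator_eq_zero'.2 <| Set.disjoint_right.2 fun x (hx : x q = 1) hsupp =>
      hsupp (C.initState_apply_of_notMem ξ fun h => zero_ne_one ((h q hq).symm.trans hx))
  rw [weight, hzero, sqNorm_zero]

theorem sqNorm_initState (ξ : Config C.inputs → ℂ) : sqNorm (C.initState ξ) = sqNorm ξ := by
  symm
  refine Finset.sum_of_injOn C.padInput ?_ (by simp) ?_ ?_
  · intro y _ y' _ h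
    rw [← C.padInput_comp y, h, padInput_comp]
  · intro x _ hx
    rw [C.initState_apply_of_notMem ξ fun h => hx ⟨_, by simp, C.padInput_eq h⟩, norm_zero,
      zero_pow two_ne_zero]
  · intro y _
    rw [initState_padInput]

theorem initState_smul (a : ℂ) (ξ : Config C.inputs → ℂ) :
    C.initState (a • ξ) = a • C.initState ξ := by
  ext x
  simp only [initState, Pi.smul_apply, smul_eq_mul, mul_ite, mul_zero]

end Input

variable [NeZero N] [NeZero R]

theorem numSteps_pos (N R : ℕ) [NeZero N] [NeZero R] : 0 < numSteps N R :=
  Nat.mul_pos (by have := Nat.pos_of_neZero R; lia) (Nat.pos_of_neZero N)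

theorem step_gate_time (r : Fin R) (j : Fin N) :
    step N R (2 * r * N + j + 1) = Step.gate r j := by
  simp [step, mul_add_div_of_lt j.isLt, Nat.mul_add_mod_of_lt j.isLt]

theorem firstTime_mem (q : CompQubit N R) :
    1 ≤ C.firstTime q ∧ C.firstTime q ≤ numSteps N R ∧
      q ∈ C.stepQubits (step N R (C.firstTime q)) := by
  classical
  refine Nat.sInf_mem (s := {t | 1 ≤ t ∧ t ≤ numSteps N R ∧ q ∈ C.stepQubits (step N R t)}) ?_
  obtain ⟨r, j⟩ := q
  by_cases hj : j ∈ Set.range (C.gate r).wires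
  · obtain ⟨i, hi⟩ := (Set.finite_range (C.gate r).wires).exists_minimal ⟨j, hj⟩
    have hleast : IsLeast (Set.range (C.gate r).wires) i :=
      ⟨hi.1, fun k hk => (le_total i k).elim id fun h => hi.2 hk h⟩
    refine ⟨2 * r * N + i + 1, Nat.le_add_left _ _, gate_time_le r i, ?_⟩
    rw [step_gate_time, stepQubits, if_pos hleast]
    exact ⟨j, hj, rfl⟩
  · refine ⟨2 * r * N + j + 1, Nat.le_add_left _ _, gate_time_le r j, ?_⟩
    rw [step_gate_time, stepQubits, if_neg fun h => hj h.1, if_neg hj]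
    rfl

theorem exists_firstTime_eq_succ (q : CompQubit N R) :
    ∃ s : ClockQubit N R, C.firstTime q = s + 1 := by
  obtain ⟨hpos, hle, -⟩ := C.firstTime_mem q
  exact ⟨⟨C.firstTime q - 1, by lia⟩, (Nat.sub_add_cancel hpos).symm⟩

theorem U_unitary (t : ℕ) : (C.U t)ᴴ * C.U t = 1 := C.stepOp_unitary _

theorem actsTriviallyOn_U_of_lt {q : CompQubit N R} {t : ℕ} (ht : 1 ≤ t)
    (hlt : t < C.firstTime q) : ActsTriviallyOn (C.U t) q :=
  opSupport_subset_iff.1 (C.opSupport_stepOp_subset _) q fun hq =>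
    Nat.notMem_of_lt_sInf hlt ⟨ht, hlt.le.trans (C.firstTime_mem q).2.1, hq⟩

/-- The product `U_t ⋯ U_1`. -/
def prefixOp : ℕ → QOp (CompQubit N R)
  | 0 => 1
  | t + 1 => C.U (t + 1) * prefixOp t

theorem prefixOp_unitary (t : ℕ) : (C.prefixOp t)ᴴ * C.prefixOp t = 1 := by
  induction t with
  | zero => simp [prefixOp]
  | succ t ih =>
    rw [prefixOp, Matrix.conjTranspose_mul, Matrix.mul_assoc, ← Matrix.mul_assoc _ (C.U (t + 1)),
      C.U_unitary, Matrix.one_mul, ih]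

theorem evolved_eq_prefixOp_mulVec (ξ : Config C.inputs → ℂ) (t : ℕ) :
    C.evolved ξ t = C.prefixOp t *ᵥ C.initState ξ := by
  induction t with
  | zero => simp [evolved, prefixOp]
  | succ t ih => rw [evolved, ih, prefixOp, Matrix.mulVec_mulVec]

theorem prefixOp_mulVec_indicator {q : CompQubit N R} {t : ℕ} (ht : t < C.firstTime q)
    (b : Fin 2) (φ : Config (CompQubit N R) → ℂ) :
    C.prefixOp t *ᵥ {x | x q = b}.indicator φ = {x | x q = b}.indicator (C.prefixOp t *ᵥ φ) := by
  induction t with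
  | zero => simp [prefixOp]
  | succ t ih =>
    rw [prefixOp, ← Matrix.mulVec_mulVec, ih (Nat.lt_of_succ_lt ht),
      (C.actsTriviallyOn_U_of_lt (Nat.le_add_left _ _) ht).mulVec_indicator, Matrix.mulVec_mulVec]

theorem weight_prefixOp_mulVec {q : CompQubit N R} {t : ℕ} (ht : t < C.firstTime q)
    (b : Fin 2) (φ : Config (CompQubit N R) → ℂ) :
    weight {x | x q = b} (C.prefixOp t *ᵥ φ) = weight {x | x q = b} φ := by
  rw [weight, ← C.prefixOp_mulVec_indicator ht, sqNorm_mulVec_of_unitary (C.prefixOp_unitary t),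
    weight]

/-! ### Acceptance -/

theorem sqNorm_evolved (ξ : Config C.inputs → ℂ) (t : ℕ) :
    sqNorm (C.evolved ξ t) = sqNorm ξ := by
  rw [evolved_eq_prefixOp_mulVec, sqNorm_mulVec_of_unitary (C.prefixOp_unitary t),
    sqNorm_initState]

theorem setOf_qout_eq_zero :
    {x : Config (CompQubit N R) | x (qout N R) = 0} = {x | x (qout N R) = 1}ᶜ := by
  ext x
  change x (qout N R) = 0 ↔ ¬ x (qout N R) = 1
  lia

theorem acceptProb_eq_weight (ξ : Config C.inputs → ℂ) :
    C.acceptProb ξ = weight {x | x (qout N R) = 1} (C.evolved ξ (numSteps N R)) := by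
  classical
  rw [acceptProb, weight_eq_sum]
  refine Finset.sum_congr rfl fun x _ => ?_
  by_cases hx : x (qout N R) = 1 <;> simp [hx]

theorem acceptProb_smul (a : ℂ) (ξ : Config C.inputs → ℂ) :
    C.acceptProb (a • ξ) = ‖a‖ ^ 2 * C.acceptProb ξ := by
  simp only [acceptProb_eq_weight, evolved_eq_prefixOp_mulVec, initState_smul, Matrix.mulVec_smul,
    weight_smul]

theorem acceptProb_le {ε : ℝ} (h : ∀ ξ : Config C.inputs → ℂ, IsState ξ → C.acceptProb ξ < ε)
    (ξ : Config C.inputs → ℂ) : C.acceptProb ξ ≤ ε * sqNorm ξ := by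
  by_cases h0 : ξ = 0
  · have hzero := C.acceptProb_smul 0 ξ
    rw [zero_smul, norm_zero, zero_pow two_ne_zero, zero_mul] at hzero
    simp [hzero, h0, sqNorm]
  · have hpos := sqNorm_pos h0
    set a : ℂ := (((√(sqNorm ξ))⁻¹ : ℝ) : ℂ)
    have ha : ‖a‖ ^ 2 = (sqNorm ξ)⁻¹ := by
      rw [Complex.norm_real, Real.norm_eq_abs, sq_abs, inv_pow, Real.sq_sqrt hpos.le]
    have hstate : IsState (a • ξ) := by
      change sqNorm (a • ξ) = 1
      rw [sqNorm_smul, ha, inv_mul_cancel₀ hpos.ne']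
    have hlt := h _ hstate
    rw [acceptProb_smul, ha, inv_mul_lt_iff₀ hpos] at hlt
    linarith

theorem nonneg_of_acceptProb_lt {ε : ℝ}
    (h : ∀ ξ : Config C.inputs → ℂ, IsState ξ → C.acceptProb ξ < ε) : 0 ≤ ε := by
  have hle := C.acceptProb_le h (Pi.single 0 1)
  have hnorm : sqNorm (Pi.single 0 1 : Config C.inputs → ℂ) = 1 := by
    simp [sqNorm, Pi.single_apply, apply_ite (‖·‖), ite_pow]
  rw [hnorm, mul_one, acceptProb_eq_weight] at hle
  exact (weight_nonneg _ _).trans hle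

theorem mul_sqNorm_le_of_acceptProb_lt {ε : ℝ}
    (h : ∀ ξ : Config C.inputs → ℂ, IsState ξ → C.acceptProb ξ < ε)
    (χ : Config (CompQubit N R) → ℂ) :
    (1 - ε - √ε) * sqNorm χ ≤ weight (⋃ q : {q // q ∉ C.Qin}, {x | x q = 1}) χ
      + weight {x | x (qout N R) = 0} (C.prefixOp (numSteps N R) *ᵥ χ) := by
  rw [← compl_validInputs, setOf_qout_eq_zero]
  refine mul_sqNorm_le_weight_compl_add_weight_compl (C.prefixOp_unitary _)
    (C.nonneg_of_acceptProb_lt h) (fun α hα => ?_) χ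
  obtain ⟨ξ, rfl⟩ := C.exists_initState_eq hα
  rw [← evolved_eq_prefixOp_mulVec, ← acceptProb_eq_weight, sqNorm_initState]
  exact C.acceptProb_le h ξ

end VerifierCircuit

namespace VerifierCircuit

/-! ### Energies of the terms -/

theorem update_mem_validClocks {T : ℕ} {s : Fin T} {z : Config (Fin T)} (hs : AtFront s z)
    (hz : z ∈ validClocks T) (b : Fin 2) : Function.update z s b ∈ validClocks T := by
  obtain ⟨t, ht, rfl⟩ := mem_validClocks.1 hz
  have hts := (atFront_clockString_iff s ht _).1 ⟨hs, rfl⟩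
  rw [hts, update_clockString]
  exact mem_validClocks.2 ⟨s + b, by lia, rfl⟩

theorem le_sum_atFront {T : ℕ} {F : Config (Fin T) → ℝ} (hF : ∀ z, 0 ≤ F z) (s : Fin T)
    (a : Fin 2) :
    F (clockString T (s + a)) ≤ ∑ z, if AtFront s z ∧ z s = a then F z else 0 := by
  refine le_trans ?_ (Finset.single_le_sum (fun z _ => ?_)
    (Finset.mem_univ (clockString T (s + a))))
  · rw [if_pos ((atFront_clockString_iff s (by lia) a).2 rfl)]
  · exact ite_nonneg (hF z) le_rfl

theorem sum_atFront_eq {T : ℕ} {F : Config (Fin T) → ℝ} {s : Fin T}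
    (hF : ∀ z ∉ validClocks T, AtFront s z → F z = 0) (a : Fin 2) :
    ∑ z, (if AtFront s z ∧ z s = a then F z else 0) = F (clockString T (s + a)) := by
  rw [Finset.sum_eq_single_of_mem (clockString T (s + a)) (Finset.mem_univ _),
    if_pos ((atFront_clockString_iff s (by lia) a).2 rfl)]
  intro z _ hne
  rw [ite_eq_right_iff]
  rintro ⟨hs, hz⟩
  refine hF z (fun hvalid => hne ?_) hs
  obtain ⟨t, ht, rfl⟩ := mem_validClocks.1 hvalid
  rw [(atFront_clockString_iff s ht a).1 ⟨hs, hz⟩]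

theorem clockBit_clockString_self (T : ℕ) : clockBit (clockString T T) T = 1 := by
  rw [clockBit_clockString le_rfl, if_pos le_rfl]

variable {N R : ℕ}

theorem energy_clockTerm (t : ℕ) (v : Config (Qubit N R) → ℂ) :
    energy (clockTerm N R t) v
      = ∑ z, if clockBit z t = 0 ∧ clockBit z (t + 1) = 1 then sqNorm (slice v z) else 0 := by
  rw [clockTerm, energy_tensorOp_diagonal]
  simp only [energy_one]

theorem sum_compl_validClocks_le_energy_Hclock (v : Config (Qubit N R) → ℂ) :
    ∑ z ∈ (validClocks (numSteps N R))ᶜ, sqNorm (slice v z) ≤ energy (Hclock N R) v := by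
  have hnonneg (z : Config (ClockQubit N R)) (s : Fin (numSteps N R - 1)) :
      0 ≤ if clockBit z (s + 1) = 0 ∧ clockBit z (s + 1 + 1) = 1 then
        sqNorm (slice v z) else 0 := ite_nonneg (sqNorm_nonneg _) le_rfl
  simp only [Hclock, energy_sum, energy_clockTerm]
  rw [Finset.sum_comm]
  refine (Finset.sum_le_sum fun z hz => ?_).trans (Finset.sum_le_univ_sum_of_nonneg fun z =>
    Finset.sum_nonneg fun s _ => hnonneg z s)
  obtain ⟨s, hs⟩ := exists_violation_of_notMem_validClocks (Finset.mem_compl.1 hz)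
  refine le_trans ?_ (Finset.single_le_sum (fun s _ => hnonneg z s) (Finset.mem_univ s))
  rw [if_pos hs]

theorem energy_Hclock_eq_zero {v : Config (Qubit N R) → ℂ}
    (hv : ∀ z ∉ validClocks (numSteps N R), slice v z = 0) : energy (Hclock N R) v = 0 := by
  rw [Hclock, energy_sum]
  refine Finset.sum_eq_zero fun s _ => ?_
  rw [energy_clockTerm]
  refine Finset.sum_eq_zero fun z _ => ?_
  by_cases hz : z ∈ validClocks (numSteps N R)
  · obtain ⟨t, ht, rfl⟩ := mem_validClocks.1 hz
    rw [if_neg]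
    rw [clockBit_clockString ht, clockBit_clockString ht]
    grind
  · rw [hv z hz, sqNorm_zero, ite_self]

variable [NeZero N] [NeZero R]

theorem energy_outTerm (v : Config (Qubit N R) → ℂ) :
    energy (outTerm N R) v = ∑ z, if clockBit z (numSteps N R) = 1 then
      weight {x | x (qout N R) = 0} (slice v z) else 0 := by
  rw [outTerm, energy_tensorOp_diagonal]
  simp only [energy_bitProj]

theorem weight_le_energy_outTerm (v : Config (Qubit N R) → ℂ) :
    weight {x | x (qout N R) = 0} (slice v (clockString (numSteps N R) (numSteps N R)))
      ≤ energy (outTerm N R) v := by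
  rw [energy_outTerm]
  refine le_trans ?_ (Finset.single_le_sum (fun z _ => ?_)
    (Finset.mem_univ (clockString (numSteps N R) (numSteps N R))))
  · rw [if_pos (clockBit_clockString_self _)]
  · exact ite_nonneg (weight_nonneg _ _) le_rfl

theorem energy_outTerm_eq {v : Config (Qubit N R) → ℂ}
    (hv : ∀ z ∉ validClocks (numSteps N R), slice v z = 0) :
    energy (outTerm N R) v
      = weight {x | x (qout N R) = 0} (slice v (clockString (numSteps N R) (numSteps N R))) := by
  rw [energy_outTerm, Finset.sum_eq_single_of_mem
    (clockString (numSteps N R) (numSteps N R)) (Finset.mem_univ _),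
    if_pos (clockBit_clockString_self _)]
  intro z _ hne
  by_cases hz : z ∈ validClocks (numSteps N R)
  · obtain ⟨t, ht, rfl⟩ := mem_validClocks.1 hz
    have hlt : ¬ numSteps N R ≤ t := fun h => hne (by rw [ht.antisymm h])
    simp [clockBit_clockString ht, hlt]
  · rw [hv z hz, weight_zero, ite_self]

variable (C : VerifierCircuit N R)

theorem energy_inTerm {q : CompQubit N R} {s : ClockQubit N R} (hs : C.firstTime q = s + 1)
    (v : Config (Qubit N R) → ℂ) :
    energy (C.inTerm q) v
      = ∑ z, if AtFront s z ∧ z s = 0 then weight {x | x q = 1} (slice v z) else 0 := by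
  rw [inTerm, hs, clockOp_self, energy_tensorOp_diagonal]
  simp only [energy_bitProj]

theorem weight_le_energy_inTerm (q : CompQubit N R) (v : Config (Qubit N R) → ℂ) :
    weight {x | x q = 1} (slice v (clockString (numSteps N R) (C.firstTime q - 1)))
      ≤ energy (C.inTerm q) v := by
  obtain ⟨s, hs⟩ := C.exists_firstTime_eq_succ q
  rw [C.energy_inTerm hs, hs]
  exact le_sum_atFront (fun z => weight_nonneg _ (slice v z)) s 0

theorem energy_inTerm_eq {v : Config (Qubit N R) → ℂ}
    (hv : ∀ z ∉ validClocks (numSteps N R), slice v z = 0) (q : CompQubit N R) :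
    energy (C.inTerm q) v
      = weight {x | x q = 1} (slice v (clockString (numSteps N R) (C.firstTime q - 1))) := by
  obtain ⟨s, hs⟩ := C.exists_firstTime_eq_succ q
  rw [C.energy_inTerm hs, hs, sum_atFront_eq (fun z hz _ => by rw [hv z hz, weight_zero])]
  rfl

/-- The operator `|100⟩⟨110| - U_t ⊗ |100⟩⟨100|` for `t = s + 1`, a square root of
`H_evolv(t)`. -/
def evolvRoot (s : ClockQubit N R) : QOp (Qubit N R) :=
  tensorOp 1 (clockOp (numSteps N R) (s + 1) ![1, 0, 0] ![1, 1, 0])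
    - tensorOp (C.U (s + 1)) (clockOp (numSteps N R) (s + 1) ![1, 0, 0] ![1, 0, 0])

theorem evolvTerm_eq_conjTranspose_mul_self (s : ClockQubit N R) :
    C.evolvTerm (s + 1) = (C.evolvRoot s)ᴴ * C.evolvRoot s := by
  rw [evolvRoot, Matrix.conjTranspose_sub, tensorOp_conjTranspose, tensorOp_conjTranspose,
    clockOp_conjTranspose, clockOp_conjTranspose, Matrix.sub_mul, Matrix.mul_sub, Matrix.mul_sub,
    tensorOp_mul, tensorOp_mul, tensorOp_mul, tensorOp_mul, clockOp_mul, clockOp_mul, clockOp_mul,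
    clockOp_mul, C.U_unitary, evolvTerm]
  simp only [Matrix.conjTranspose_one, Matrix.one_mul, Matrix.mul_one]
  abel

theorem slice_evolvRoot_mulVec (s : ClockQubit N R) (v : Config (Qubit N R) → ℂ)
    (z : Config (ClockQubit N R)) :
    slice (C.evolvRoot s *ᵥ v) z = if AtFront s z ∧ z s = 0 then
      slice v (Function.update z s 1) - C.U (s + 1) *ᵥ slice v z else 0 := by
  rw [evolvRoot, Matrix.sub_mulVec]
  change slice (tensorOp _ _ *ᵥ v) z - slice (tensorOp _ _ *ᵥ v) z = _
  simp only [slice_tensorOp_mulVec, clockOp_apply, Matrix.one_mulVec]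
  by_cases h : AtFront s z ∧ z s = 0
  · have hz : Function.update z s 0 = z := h.2 ▸ Function.update_eq_self s z
    simp [h, hz]
  · simp [h]

theorem energy_evolvTerm (s : ClockQubit N R) (v : Config (Qubit N R) → ℂ) :
    energy (C.evolvTerm (s + 1)) v = ∑ z, if AtFront s z ∧ z s = 0 then
      sqNorm (slice v (Function.update z s 1) - C.U (s + 1) *ᵥ slice v z) else 0 := by
  rw [evolvTerm_eq_conjTranspose_mul_self, energy_conjTranspose_mul_self, sqNorm_eq_sum_slice]
  simp only [slice_evolvRoot_mulVec, apply_ite sqNorm, sqNorm_zero]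

theorem sqNorm_le_energy_evolvTerm (s : ClockQubit N R) (v : Config (Qubit N R) → ℂ) :
    sqNorm (slice v (clockString (numSteps N R) (s + 1))
        - C.U (s + 1) *ᵥ slice v (clockString (numSteps N R) s))
      ≤ energy (C.evolvTerm (s + 1)) v := by
  rw [energy_evolvTerm]
  refine le_trans ?_ (le_sum_atFront (fun z => sqNorm_nonneg _) s 0)
  rw [update_clockString]
  rfl

theorem energy_evolvTerm_eq {v : Config (Qubit N R) → ℂ}
    (hv : ∀ z ∉ validClocks (numSteps N R), slice v z = 0) (s : ClockQubit N R) :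
    energy (C.evolvTerm (s + 1)) v = sqNorm (slice v (clockString (numSteps N R) (s + 1))
        - C.U (s + 1) *ᵥ slice v (clockString (numSteps N R) s)) := by
  rw [energy_evolvTerm, sum_atFront_eq, update_clockString]
  · rfl
  · intro z hz hs
    have hz' : Function.update z s 1 ∉ validClocks (numSteps N R) := fun h => hz <| by
      simpa using update_mem_validClocks ((atFront_update s z 1).2 hs) h (z s)
    rw [hv z hz, hv _ hz', Matrix.mulVec_zero, sub_zero, sqNorm_zero]

open Classical in
theorem energy_hamiltonian (v : Config (Qubit N R) → ℂ) :
    energy C.hamiltonian v = ∑ q : {q // q ∉ C.Qin}, energy (C.inTerm q) v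
      + energy (outTerm N R) v + energy (Hclock N R) v
      + 1 / 2 * ∑ s : ClockQubit N R, energy (C.evolvTerm (s + 1)) v := by
  have h : (1 / 2 : ℂ) = ((1 / 2 : ℝ) : ℂ) := by norm_num
  rw [hamiltonian, Hin, energy_add, energy_add, energy_add, energy_sum, h, energy_ofReal_smul,
    energy_sum]

open scoped ComplexOrder in
theorem hamiltonian_posSemidef : C.hamiltonian.PosSemidef := by
  classical
  have hdiag {ι : Type} [DecidableEq ι] (p : ι → Prop) [DecidablePred p] :
      (Matrix.diagonal fun x => if p x then (1 : ℂ) else 0).PosSemidef :=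
    Matrix.PosSemidef.diagonal fun x => ite_nonneg zero_le_one le_rfl
  have hclockOp (s : ClockQubit N R) :
      (clockOp (numSteps N R) (s + 1) ![1, 0, 0] ![1, 0, 0]).PosSemidef := by
    rw [clockOp_self]
    exact hdiag _
  refine ((Matrix.PosSemidef.add ?_ ?_).add ?_).add ?_
  · refine Matrix.posSemidef_sum _ fun q _ => tensorOp_posSemidef (hdiag _) ?_
    obtain ⟨s, hs⟩ := C.exists_firstTime_eq_succ q
    rw [hs]
    exact hclockOp s
  · exact tensorOp_posSemidef (hdiag _) (hdiag _)
  · exact Matrix.posSemidef_sum _ fun s _ => tensorOp_posSemidef Matrix.PosSemidef.one (hdiag _)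
  · refine (Matrix.posSemidef_sum _ fun s _ => ?_).smul
      (div_nonneg zero_le_one zero_le_two)
    rw [evolvTerm_eq_conjTranspose_mul_self]
    exact Matrix.posSemidef_conjTranspose_mul_self _

open scoped ComplexOrder in
theorem hamiltonian_isHermitian : C.hamiltonian.IsHermitian :=
  C.hamiltonian_posSemidef.isHermitian

/-! ### The history state -/

theorem slice_historyState (ξ : Config C.inputs → ℂ) {t : ℕ} (ht : t ≤ numSteps N R) :
    slice (C.historyState ξ) (clockString (numSteps N R) t)
      = ((√(1 / ((numSteps N R : ℝ) + 1)) : ℝ) : ℂ) • C.evolved ξ t := by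
  ext x
  simp only [slice, historyState, Sum.elim_comp_inl, Sum.elim_comp_inr, Pi.smul_apply, smul_eq_mul]
  congr 1
  rw [Finset.sum_eq_single_of_mem t (Finset.mem_range_succ_iff.2 ht)]
  · simp
  · intro t' ht' hne
    have h : clockString (numSteps N R) t ≠ clockString (numSteps N R) t' := fun h =>
      hne (clockString_injOn ht' (Finset.mem_coe.2 (Finset.mem_range_succ_iff.2 ht)) h.symm)
    simp [h]

theorem slice_historyState_of_notMem (ξ : Config C.inputs → ℂ) (z : Config (ClockQubit N R))
    (hz : z ∉ validClocks (numSteps N R)) : slice (C.historyState ξ) z = 0 := by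
  ext x
  simp only [slice, historyState, Sum.elim_comp_inl, Sum.elim_comp_inr, Pi.zero_apply]
  rw [Finset.sum_eq_zero, mul_zero]
  intro t ht
  have h : z ≠ clockString (numSteps N R) t := fun h =>
    hz (mem_validClocks.2 ⟨t, Finset.mem_range_succ_iff.1 ht, h.symm⟩)
  simp [h]

theorem energy_inTerm_historyState {q : CompQubit N R} (hq : q ∉ C.Qin)
    (ξ : Config C.inputs → ℂ) : energy (C.inTerm q) (C.historyState ξ) = 0 := by
  obtain ⟨hpos, hle, -⟩ := C.firstTime_mem q
  rw [C.energy_inTerm_eq (C.slice_historyState_of_notMem ξ), C.slice_historyState ξ (by lia),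
    weight_smul, evolved_eq_prefixOp_mulVec, C.weight_prefixOp_mulVec (by lia),
    C.weight_initState hq, mul_zero]

theorem energy_evolvTerm_historyState (s : ClockQubit N R) (ξ : Config C.inputs → ℂ) :
    energy (C.evolvTerm (s + 1)) (C.historyState ξ) = 0 := by
  rw [C.energy_evolvTerm_eq (C.slice_historyState_of_notMem ξ),
    C.slice_historyState ξ (by lia), C.slice_historyState ξ (by lia), Matrix.mulVec_smul, evolved,
    sub_self, sqNorm_zero]

theorem energy_outTerm_historyState {ξ : Config C.inputs → ℂ} (hξ : IsState ξ) :
    energy (outTerm N R) (C.historyState ξ)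
      = (1 - C.acceptProb ξ) / ((numSteps N R : ℝ) + 1) := by
  have hsum := weight_add_weight_compl {x | x (qout N R) = 1} (C.evolved ξ (numSteps N R))
  rw [sqNorm_evolved, show sqNorm ξ = 1 from hξ, ← acceptProb_eq_weight, ← setOf_qout_eq_zero]
    at hsum
  rw [energy_outTerm_eq (C.slice_historyState_of_notMem ξ), C.slice_historyState ξ le_rfl,
    weight_smul, Complex.norm_real, Real.norm_eq_abs, sq_abs, Real.sq_sqrt (by positivity),
    eq_sub_of_add_eq' hsum]
  ring

theorem energy_historyState {ξ : Config C.inputs → ℂ} (hξ : IsState ξ) :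
    energy C.hamiltonian (C.historyState ξ)
      = (1 - C.acceptProb ξ) / ((numSteps N R : ℝ) + 1) := by
  classical
  rw [energy_hamiltonian, Finset.sum_eq_zero fun q _ => C.energy_inTerm_historyState q.2 ξ,
    C.energy_outTerm_historyState hξ, energy_Hclock_eq_zero (C.slice_historyState_of_notMem ξ),
    Finset.sum_eq_zero fun s _ => C.energy_evolvTerm_historyState s ξ]
  ring

/-! ### The energy gap -/

theorem card_compQubit_le_numSteps (N R : ℕ) : Fintype.card (CompQubit N R) ≤ numSteps N R := by
  rw [Fintype.card_prod, Fintype.card_fin, Fintype.card_fin, numSteps]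
  exact Nat.mul_le_mul_right N (by lia)

open Classical in
theorem mul_sqNorm_slice_le {ε : ℝ}
    (h : ∀ ξ : Config C.inputs → ℂ, IsState ξ → C.acceptProb ξ < ε)
    (v : Config (Qubit N R) → ℂ) {s : ℕ} (hs : s ≤ numSteps N R) :
    (1 - ε - √ε) * sqNorm (slice v (clockString (numSteps N R) s))
      ≤ 2 * ∑ q : {q // q ∉ C.Qin}, energy (C.inTerm q) v + 2 * energy (outTerm N R) v
        + 2 * (numSteps N R + 1)
          * (numSteps N R * ∑ s : ClockQubit N R, energy (C.evolvTerm (s + 1)) v) := by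
  set T := numSteps N R
  let φ (t : ℕ) : Config (CompQubit N R) → ℂ := (C.prefixOp t)ᴴ *ᵥ slice v (clockString T t)
  have hφ (t : ℕ) : C.prefixOp t *ᵥ φ t = slice v (clockString T t) := by
    rw [Matrix.mulVec_mulVec, mul_eq_one_comm.1 (C.prefixOp_unitary t), Matrix.one_mulVec]
  have hpath := mul_sqNorm_le_of_path (C.prefixOp_unitary T) (C.mul_sqNorm_le_of_acceptProb_lt h) φ
    (τ := fun q => C.firstTime q - 1)
    (fun q => (Nat.sub_le _ _).trans (C.firstTime_mem q).2.1) hs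
  rw [← hφ s, sqNorm_mulVec_of_unitary (C.prefixOp_unitary s)]
  refine hpath.trans ?_
  gcongr with q
  · rw [← C.weight_prefixOp_mulVec (Nat.sub_one_lt_of_le (C.firstTime_mem q).1 le_rfl), hφ]
    exact C.weight_le_energy_inTerm q v
  · rw [hφ]
    exact weight_le_energy_outTerm v
  · exact mul_nonneg (Nat.cast_nonneg _) (Finset.sum_nonneg fun i _ => sqNorm_nonneg _)
  · exact (Fintype.card_subtype_le (· ∉ C.Qin)).trans (card_compQubit_le_numSteps N R)
  · rw [Finset.sum_range]
    refine Finset.sum_le_sum fun t _ => ?_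
    rw [← sqNorm_mulVec_of_unitary (C.prefixOp_unitary (t + 1)), Matrix.mulVec_sub, hφ, prefixOp,
      ← Matrix.mulVec_mulVec, hφ]
    exact C.sqNorm_le_energy_evolvTerm t v

theorem mul_sum_sqNorm_slice_le {ε : ℝ}
    (h : ∀ ξ : Config C.inputs → ℂ, IsState ξ → C.acceptProb ξ < ε)
    (v : Config (Qubit N R) → ℂ) :
    (1 - ε - √ε) * ∑ z ∈ validClocks (numSteps N R), sqNorm (slice v z)
      ≤ 16 * (numSteps N R : ℝ) ^ 3 * (energy C.hamiltonian v - energy (Hclock N R) v) := by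
  classical
  have hT : (1 : ℝ) ≤ numSteps N R := by exact_mod_cast numSteps_pos N R
  have hbound := Finset.sum_le_card_nsmul (Finset.range (numSteps N R + 1))
    (fun t => (1 - ε - √ε) * sqNorm (slice v (clockString (numSteps N R) t))) _ fun t ht =>
      C.mul_sqNorm_slice_le h v (Finset.mem_range_succ_iff.1 ht)
  rw [energy_hamiltonian, sum_validClocks, Finset.mul_sum]
  rw [Finset.card_range, nsmul_eq_mul, Nat.cast_succ] at hbound
  set T : ℝ := (numSteps N R : ℝ)
  set Ein := ∑ q : {q // q ∉ C.Qin}, energy (C.inTerm q) v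
  set Eout := energy (outTerm N R) v
  set Eev := ∑ s : ClockQubit N R, energy (C.evolvTerm (s + 1)) v
  have hin : 0 ≤ Ein := Finset.sum_nonneg fun q _ =>
    (weight_nonneg _ _).trans (C.weight_le_energy_inTerm q v)
  have hout : 0 ≤ Eout := (weight_nonneg _ _).trans (weight_le_energy_outTerm v)
  have hev : 0 ≤ Eev := Finset.sum_nonneg fun s _ =>
    (sqNorm_nonneg _).trans (C.sqNorm_le_energy_evolvTerm s v)
  have hT3 : T ≤ T ^ 3 := le_self_pow₀ hT three_ne_zero
  have hmargin : (T + 1) * (2 * Ein + 2 * Eout) ≤ 16 * T ^ 3 * (Ein + Eout) := by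
    nlinarith [add_nonneg hin hout]
  have hprop : (T + 1) * (2 * (T + 1) * (T * Eev)) ≤ 8 * T ^ 3 * Eev := by
    have : (T + 1) * (2 * (T + 1) * T) ≤ 8 * T ^ 3 := by nlinarith
    nlinarith
  linarith

theorem mul_sqNorm_le_energy_hamiltonian {ε : ℝ}
    (h : ∀ ξ : Config C.inputs → ℂ, IsState ξ → C.acceptProb ξ < ε)
    (v : Config (Qubit N R) → ℂ) :
    1 / 16 * (1 - ε - √ε) / (numSteps N R : ℝ) ^ 3 * sqNorm v ≤ energy C.hamiltonian v := by
  have hT : (1 : ℝ) ≤ (numSteps N R : ℝ) ^ 3 :=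
    one_le_pow₀ (by exact_mod_cast numSteps_pos N R)
  have hδ : 1 - ε - √ε ≤ 1 := by linarith [Real.sqrt_nonneg ε, C.nonneg_of_acceptProb_lt h]
  have hvalid := C.mul_sum_sqNorm_slice_le h v
  have hinvalid : (1 - ε - √ε) * ∑ z ∈ (validClocks (numSteps N R))ᶜ, sqNorm (slice v z)
      ≤ 16 * (numSteps N R : ℝ) ^ 3 * energy (Hclock N R) v :=
    mul_le_mul (by linarith) (sum_compl_validClocks_le_energy_Hclock v)
      (Finset.sum_nonneg fun _ _ => sqNorm_nonneg _) (by positivity)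
  rw [sqNorm_eq_sum_slice, ← Finset.sum_add_sum_compl (validClocks (numSteps N R)),
    div_mul_eq_mul_div, div_le_iff₀ (by positivity)]
  linarith

theorem le_of_hasEigenvalue {ε : ℝ}
    (h : ∀ ξ : Config C.inputs → ℂ, IsState ξ → C.acceptProb ξ < ε) {μ : ℝ}
    (hμ : Module.End.HasEigenvalue (Matrix.toLin' C.hamiltonian) (μ : ℂ)) :
    1 / 16 * (1 - ε - √ε) / (numSteps N R : ℝ) ^ 3 ≤ μ := by
  obtain ⟨v, hv⟩ := hμ.exists_hasEigenvector
  have hle := C.mul_sqNorm_le_energy_hamiltonian h v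
  rw [energy_of_hasEigenvector hv] at hle
  exact le_of_mul_le_mul_right hle (sqNorm_pos hv.2)

end VerifierCircuit

/-! ### Lattice drawings -/

/-- A lattice point as a point of the Euclidean plane; the lattice itself carries the sup
distance. -/
def planePoint (p : ℤ × ℤ) : EuclideanSpace ℝ (Fin 2) := !₂[(p.1 : ℝ), (p.2 : ℝ)]

theorem dist_le_natCast_iff {p p' : ℤ × ℤ} {d : ℕ} :
    dist p p' ≤ d ↔ |p.1 - p'.1| ≤ d ∧ |p.2 - p'.2| ≤ d := by
  rw [Prod.dist_eq, max_le_iff, Int.dist_eq, Int.dist_eq]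
  norm_cast

theorem one_le_dist_of_ne {p p' : ℤ × ℤ} (h : p ≠ p') : 1 ≤ dist p p' := by
  rw [Prod.dist_eq, le_max_iff]
  by_contra! hlt
  exact h (Prod.ext (by_contra fun hne => hlt.1.not_ge (Int.pairwise_one_le_dist hne))
    (by_contra fun hne => hlt.2.not_ge (Int.pairwise_one_le_dist hne)))

theorem dist_le_dist_planePoint (p p' : ℤ × ℤ) :
    dist p p' ≤ dist (planePoint p) (planePoint p') := by
  rw [dist_eq_norm (planePoint p), Prod.dist_eq]
  exact max_le (PiLp.norm_apply_le (planePoint p - planePoint p') 0)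
    (PiLp.norm_apply_le (planePoint p - planePoint p') 1)

theorem dist_planePoint_le (p p' : ℤ × ℤ) :
    dist (planePoint p) (planePoint p') ≤ 2 * dist p p' := by
  have h₁ : dist (planePoint p 0) (planePoint p' 0) ≤ dist p p' := le_max_left _ _
  have h₂ : dist (planePoint p 1) (planePoint p' 1) ≤ dist p p' := le_max_right _ _
  rw [EuclideanSpace.dist_eq, Real.sqrt_le_left (by positivity), Fin.sum_univ_two]
  nlinarith [pow_le_pow_left₀ dist_nonneg h₁ 2, pow_le_pow_left₀ dist_nonneg h₂ 2,
    sq_nonneg (dist p p')]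

theorem encard_closedBall_lattice (p : ℤ × ℤ) (d : ℕ) :
    (Metric.closedBall p (d : ℝ)).encard = ((2 * d + 1) ^ 2 : ℕ) := by
  have hball (a : ℤ) : (Metric.closedBall a (d : ℝ)).encard = (2 * d + 1 : ℕ) := by
    have hIcc : Metric.closedBall a (d : ℝ) = Finset.Icc (a - d) (a + d) := by
      rw [Int.closedBall_eq_Icc, Finset.coe_Icc]
      norm_cast
      rw [Int.ceil_intCast, Int.floor_intCast]
    rw [hIcc, Set.encard_coe_eq_coe_finsetCard, Int.card_Icc]
    congr 1
    lia
  rw [← closedBall_prod_same, Set.encard_prod, hball, hball, ← Nat.cast_mul, sq]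

theorem encard_le_of_dist_le {I κ : Type*} [Fintype κ] {center : I → ℤ × ℤ} {kind : I → κ}
    (h : Function.Injective fun i => (kind i, center i)) {s : Set I} {p : ℤ × ℤ} {d : ℕ}
    (hs : ∀ i ∈ s, dist (center i) p ≤ d) :
    s.encard ≤ (Fintype.card κ * (2 * d + 1) ^ 2 : ℕ) := by
  rw [← h.encard_image, Nat.cast_mul, ← encard_closedBall_lattice p,
    ← ENat.card_eq_coe_fintype_card, ← Set.encard_univ, ← Set.encard_prod]
  refine Set.encard_le_encard ?_
  rintro _ ⟨i, hi, rfl⟩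
  exact ⟨trivial, hs i hi⟩

theorem volume_closedBall_plane_le (x : EuclideanSpace ℝ (Fin 2)) (r : ℕ) :
    MeasureTheory.volume (Metric.closedBall x r) ≤ (4 * r ^ 2 : ℕ) := by
  rw [EuclideanSpace.volume_closedBall_fin_two, ENNReal.ofReal_natCast, mul_comm]
  push_cast
  gcongr
  exact (ENNReal.ofReal_le_ofReal Real.pi_le_four).trans_eq (ENNReal.ofReal_ofNat 4)

theorem isSpatiallySparse_of_lattice_drawing {V I κ : Type*} [Fintype κ] {edge : I → Set V}
    {pos : V → ℤ × ℤ} (hpos : Function.Injective pos) {center : I → ℤ × ℤ} {kind : I → κ}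
    (hcenter : Function.Injective fun i => (kind i, center i)) {r : ℕ}
    (hr : ∀ i, ∀ v ∈ edge i, dist (pos v) (center i) ≤ r) :
    IsSpatiallySparse edge (Fintype.card κ * (8 * r + 1) ^ 2) := by
  have hconst : 8 * r + 1 = 2 * (4 * r) + 1 := by ring
  have hhull (i : I) : convexHull ℝ ((fun v => planePoint (pos v)) '' edge i)
      ⊆ Metric.closedBall (planePoint (center i)) (2 * r : ℕ) := by
    refine convexHull_min ?_ (convex_closedBall _ _)
    rintro _ ⟨v, hv, rfl⟩
    rw [Metric.mem_closedBall]
    push_cast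
    linarith [dist_planePoint_le (pos v) (center i), hr i v hv]
  refine ⟨fun v => ?_, fun v => planePoint (pos v), fun v w h => ?_, fun i => ?_, fun i => ?_⟩
  · rw [hconst]
    refine encard_le_of_dist_le hcenter (p := pos v) fun i hi => ?_
    rw [dist_comm]
    exact (hr i v hi).trans (by gcongr; lia)
  · exact (one_le_dist_of_ne (hpos.ne h)).trans (dist_le_dist_planePoint _ _)
  · rw [hconst]
    refine encard_le_of_dist_le hcenter (p := center i) ?_
    rintro j ⟨-, x, hxi, hxj⟩
    have hi := hhull i hxi
    have hj := hhull j hxj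
    rw [Metric.mem_closedBall] at hi hj
    refine (dist_le_dist_planePoint _ _).trans ((dist_triangle_left _ _ x).trans ?_)
    push_cast at hi hj ⊢
    linarith
  · have : Nonempty κ := ⟨kind i⟩
    refine (MeasureTheory.measure_mono (hhull i)).trans
      ((volume_closedBall_plane_le _ _).trans (Nat.cast_le.2 ?_))
    nlinarith [Fintype.card_pos (α := κ), sq_nonneg (8 * r + 1)]

namespace VerifierCircuit

variable {N R : ℕ} (C : VerifierCircuit N R)

/-! ### The hyperedges -/

/-- The clock qubits among `c_m, c_{m+1}, c_{m+2}`. -/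
def clockTriple (T m : ℕ) : Set (Fin T) := {s | ∃ k : Fin 3, (s : ℕ) + 1 = m + k}

theorem encard_clockTriple_le (T m : ℕ) : (clockTriple T m).encard ≤ 3 := by
  have hinj : Function.Injective fun s : Fin T => (s : ℕ) + 1 := fun s s' h =>
    Fin.ext (Nat.succ_injective h)
  rw [← hinj.encard_image]
  calc ((fun s : Fin T => (s : ℕ) + 1) '' clockTriple T m).encard
      ≤ ((fun k : Fin 3 => m + (k : ℕ)) '' Set.univ).encard := Set.encard_le_encard <| by
        rintro _ ⟨s, ⟨k, hk⟩, rfl⟩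
        exact ⟨k, trivial, hk.symm⟩
    _ ≤ (Set.univ : Set (Fin 3)).encard := Set.encard_image_le _ _
    _ = 3 := by simp

theorem opSupport_clockOp_subset (T t : ℕ) (a b : Fin 3 → Fin 2) :
    opSupport (clockOp T t a b) ⊆ clockTriple T (t - 1) :=
  opSupport_subset_iff.2 fun _ hs => actsTriviallyOn_clockOp (fun k hk => hs ⟨k, hk⟩) a b

theorem encard_stepQubits_le (st : Step N R) : (C.stepQubits st).encard ≤ 2 := by
  classical
  cases st with
  | gate r j =>
    simp only [stepQubits]
    split_ifs
    · rw [← Set.range_comp, ← Set.image_univ]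
      refine (Set.encard_image_le _ _).trans ?_
      rw [Set.encard_univ, ENat.card_eq_coe_fintype_card, Fintype.card_fin]
      exact_mod_cast (C.gate r).arity_le
    · simp
    · simp
  | swap r r' j => exact (Set.encard_insert_le _ _).trans (by rw [Set.encard_singleton]; norm_num)

theorem opSupport_clockTerm_subset (t : ℕ) :
    opSupport (clockTerm N R t) ⊆ Sum.inr '' clockTriple (numSteps N R) t := by
  refine opSupport_subset_iff.2 ?_
  rintro (q | s) hv
  · exact (actsTriviallyOn_one q).tensorOp_inl _
  · refine (actsTriviallyOn_diagonal fun z => ?_).tensorOp_inr _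
    have h₀ : t ≠ s + 1 := fun h => hv ⟨s, ⟨0, h.symm⟩, rfl⟩
    have h₁ : t + 1 ≠ s + 1 := fun h => hv ⟨s, ⟨1, h.symm⟩, rfl⟩
    rw [clockBit_update z h₀, clockBit_update z h₁]

variable [NeZero N] [NeZero R]

theorem opSupport_inTerm_subset (q : CompQubit N R) :
    opSupport (C.inTerm q)
      ⊆ Sum.inl '' {q} ∪ Sum.inr '' clockTriple (numSteps N R) (C.firstTime q - 1) :=
  (opSupport_tensorOp_subset _ _).trans <| Set.union_subset_union
    (Set.image_mono (opSupport_bitProj_subset q 1)) (Set.image_mono (opSupport_clockOp_subset ..))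

theorem opSupport_outTerm_subset :
    opSupport (outTerm N R)
      ⊆ Sum.inl '' {qout N R} ∪ Sum.inr '' clockTriple (numSteps N R) (numSteps N R) := by
  refine (opSupport_tensorOp_subset _ _).trans <| Set.union_subset_union
    (Set.image_mono (opSupport_bitProj_subset _ 0)) (Set.image_mono ?_)
  refine opSupport_subset_iff.2 fun s hs => actsTriviallyOn_diagonal fun z => ?_
  have hT : numSteps N R ≠ s + 1 := fun h => hs ⟨0, h.symm⟩
  rw [clockBit_update z hT]

theorem opSupport_evolvTerm_subset (t : ℕ) :
    opSupport (C.evolvTerm t)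
      ⊆ Sum.inl '' C.stepQubits (step N R t) ∪ Sum.inr '' clockTriple (numSteps N R) (t - 1) := by
  refine opSupport_subset_iff.2 ?_
  rintro (q | s) hv
  · have hU : ActsTriviallyOn (C.U t) q := opSupport_subset_iff.1 (C.opSupport_stepOp_subset _) q
      fun h => hv (.inl ⟨q, h, rfl⟩)
    have hone := actsTriviallyOn_one q
    exact (((hone.tensorOp_inl _).add (hone.tensorOp_inl _)).sub (hU.tensorOp_inl _)).sub
      (hU.conjTranspose.tensorOp_inl _)
  · have hclock (a b : Fin 3 → Fin 2) : ActsTriviallyOn (clockOp (numSteps N R) t a b) s :=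
      opSupport_subset_iff.1 (opSupport_clockOp_subset ..) s fun h => hv (.inr ⟨s, h, rfl⟩)
    exact ((((hclock _ _).tensorOp_inr _).add ((hclock _ _).tensorOp_inr _)).sub
      ((hclock _ _).tensorOp_inr _)).sub ((hclock _ _).tensorOp_inr _)

/-- A set of computational qubits containing those on which a term acts. -/
def termQubits : C.TermIdx → Set (CompQubit N R)
  | .inl q => {q.1}
  | .inr (.inl _) => {qout N R}
  | .inr (.inr (.inl _)) => ∅
  | .inr (.inr (.inr s)) => C.stepQubits (step N R (s + 1))

/-- The time `m` such that a term acts on no other clock qubits than `c_m, c_{m+1}, c_{m+2}`. -/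
def termTime : C.TermIdx → ℕ
  | .inl q => C.firstTime q - 1
  | .inr (.inl _) => numSteps N R
  | .inr (.inr (.inl s)) => s + 1
  | .inr (.inr (.inr s)) => s

theorem hyperedge_subset (i : C.TermIdx) :
    C.hyperedge i
      ⊆ Sum.inl '' C.termQubits i ∪ Sum.inr '' clockTriple (numSteps N R) (C.termTime i) := by
  rcases i with q | - | s | s
  · exact C.opSupport_inTerm_subset q
  · exact opSupport_outTerm_subset
  · exact (opSupport_clockTerm_subset _).trans Set.subset_union_right
  · exact opSupport_subset_iff.2 fun v hv =>
      (opSupport_subset_iff.1 (C.opSupport_evolvTerm_subset (s + 1)) v hv).smul _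

theorem encard_termQubits_le (i : C.TermIdx) : (C.termQubits i).encard ≤ 2 := by
  rcases i with q | - | s | s
  · simp [termQubits]
  · simp [termQubits]
  · simp [termQubits]
  · exact C.encard_stepQubits_le _

theorem encard_hyperedge_le (i : C.TermIdx) : (C.hyperedge i).encard ≤ 5 := by
  refine (Set.encard_le_encard (C.hyperedge_subset i)).trans ((Set.encard_union_le _ _).trans ?_)
  rw [Sum.inl_injective.encard_image, Sum.inr_injective.encard_image]
  exact (add_le_add (C.encard_termQubits_le i) (encard_clockTriple_le _ _)).trans (by norm_num)

end VerifierCircuit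

namespace VerifierCircuit

variable {N R : ℕ}

/-! ### The drawing -/

/-- The place in the drawing of the clock qubit with index `s`: the clock follows the path of the
cursor, in two lines between consecutive rows of computational qubits, one for the gate round and
one for the swap round. -/
def clockPos (N s : ℕ) : ℤ × ℤ :=
  if s / N % 2 = 0 then (((s % N : ℕ) : ℤ), 3 * ((s / N / 2 : ℕ) : ℤ) + 1)
  else ((N : ℤ) - 1 - ((s % N : ℕ) : ℤ), 3 * ((s / N / 2 : ℕ) : ℤ) + 2)

/-- The place of a qubit in the drawing. -/
def qubitPos : Qubit N R → ℤ × ℤ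
  | .inl q => ((q.2 : ℕ), 3 * ((q.1 : ℕ) : ℤ))
  | .inr s => clockPos N s

theorem clockPos_gate_time (r : ℕ) {j : ℕ} (hj : j < N) :
    clockPos N (2 * r * N + j) = ((j : ℤ), 3 * (r : ℤ) + 1) := by
  simp [clockPos, mul_add_div_of_lt hj, Nat.mul_add_mod_of_lt hj]

theorem clockPos_swap_time (r : ℕ) {j : ℕ} (hj : j < N) :
    clockPos N ((2 * r + 1) * N + (N - 1 - j)) = ((j : ℤ), 3 * (r : ℤ) + 2) := by
  have hj' : N - 1 - j < N := by lia
  simp only [clockPos, mul_add_div_of_lt hj', Nat.mul_add_mod_of_lt hj', Prod.ext_iff]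
  grind

theorem exists_eq_gate_time_or_swap_time [NeZero N] (s : ℕ) :
    ∃ r, ∃ j < N, s = 2 * r * N + j ∨ s = (2 * r + 1) * N + (N - 1 - j) := by
  have hlt := Nat.mod_lt s (Nat.pos_of_neZero N)
  have hs := Nat.div_add_mod' s N
  obtain ⟨r, hr | hr⟩ := Nat.even_or_odd' (s / N)
  · exact ⟨r, s % N, hlt, .inl (by rw [← hr, hs])⟩
  · exact ⟨r, N - 1 - s % N, by lia, .inr (by rw [← hr]; lia)⟩

theorem clockPos_injective [NeZero N] : Function.Injective (clockPos N) := by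
  intro s s' h
  obtain ⟨r, j, hj, rfl | rfl⟩ := exists_eq_gate_time_or_swap_time (N := N) s <;>
  obtain ⟨r', j', hj', rfl | rfl⟩ := exists_eq_gate_time_or_swap_time (N := N) s' <;>
  simp only [clockPos_gate_time _ hj, clockPos_gate_time _ hj', clockPos_swap_time _ hj,
    clockPos_swap_time _ hj', Prod.mk.injEq] at h
  · obtain ⟨rfl, rfl⟩ : j = j' ∧ r = r' := by lia
    rfl
  · lia
  · lia
  · obtain ⟨rfl, rfl⟩ : j = j' ∧ r = r' := by lia
    rfl

theorem qubitPos_injective [NeZero N] : Function.Injective (qubitPos (N := N) (R := R)) := by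
  have hne (q : CompQubit N R) (s : ClockQubit N R) :
      qubitPos (.inl q : Qubit N R) ≠ qubitPos (.inr s : Qubit N R) := by
    obtain ⟨r, j, hj, hs | hs⟩ := exists_eq_gate_time_or_swap_time (N := N) s <;>
    simp only [qubitPos, hs, clockPos_gate_time _ hj, clockPos_swap_time _ hj, ne_eq,
      Prod.mk.injEq] <;>
    lia
  rintro (q | s) (q' | s') h
  · simp only [qubitPos, Prod.mk.injEq] at h
    exact congrArg Sum.inl (Prod.ext (Fin.ext (by lia)) (Fin.ext (by lia)))
  · exact absurd h (hne q s')
  · exact absurd h.symm (hne q' s)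
  · exact congrArg Sum.inr (Fin.ext (clockPos_injective h))

theorem dist_clockPos_succ_le [NeZero N] (s : ℕ) :
    dist (clockPos N s) (clockPos N (s + 1)) ≤ (2 : ℕ) := by
  rw [dist_le_natCast_iff, abs_le, abs_le]
  obtain ⟨r, j, hj, rfl | rfl⟩ := exists_eq_gate_time_or_swap_time (N := N) s
  · rw [clockPos_gate_time r hj]
    rcases Nat.lt_or_ge (j + 1) N with hlt | hge
    · rw [add_assoc, clockPos_gate_time r hlt]
      lia
    · have hnext : 2 * r * N + j + 1 = (2 * r + 1) * N + (N - 1 - j) := by grind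
      rw [hnext, clockPos_swap_time r hj]
      lia
  · rw [clockPos_swap_time r hj]
    rcases Nat.eq_zero_or_pos j with rfl | hpos
    · have hnext : (2 * r + 1) * N + (N - 1 - 0) + 1 = 2 * (r + 1) * N + 0 := by grind
      rw [hnext, clockPos_gate_time _ hj]
      lia
    · have hnext : (2 * r + 1) * N + (N - 1 - j) + 1 = (2 * r + 1) * N + (N - 1 - (j - 1)) := by
        lia
      rw [hnext, clockPos_swap_time r (by lia)]
      lia

theorem dist_clockPos_add_le [NeZero N] (s d : ℕ) :
    dist (clockPos N s) (clockPos N (s + d)) ≤ (2 * d : ℕ) := by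
  induction d with
  | zero => simp
  | succ d ih =>
    refine (dist_triangle _ _ _).trans ((add_le_add ih (dist_clockPos_succ_le _)).trans ?_)
    exact_mod_cast le_rfl

theorem dist_qubitPos_clockPos_le [NeZero N] {s m : ℕ} (hm : m ≤ s + 1) (hs : s + 1 ≤ m + 2)
    {s' : ClockQubit N R} (hs' : s' ∈ clockTriple (numSteps N R) m) :
    dist (qubitPos (.inr s' : Qubit N R)) (clockPos N s) ≤ (4 : ℕ) := by
  obtain ⟨k, hk⟩ := hs'
  rcases le_total s s' with hle | hle
  · obtain ⟨d, hd⟩ := Nat.exists_eq_add_of_le hle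
    rw [dist_comm, qubitPos, hd]
    exact (dist_clockPos_add_le s d).trans (Nat.cast_le.2 (by lia))
  · obtain ⟨d, rfl⟩ := Nat.exists_eq_add_of_le hle
    exact (dist_clockPos_add_le _ d).trans (Nat.cast_le.2 (by lia))

variable (C : VerifierCircuit N R)

theorem mem_stepQubits_gate (hC : C.NearestNeighbour) {r : Fin R} {j : Fin N}
    {q : CompQubit N R} (hq : q ∈ C.stepQubits (.gate r j)) :
    q.1 = r ∧ (j : ℕ) ≤ q.2 + 1 ∧ (q.2 : ℕ) ≤ j + 1 := by
  simp only [stepQubits] at hq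
  split_ifs at hq with hleast
  · obtain ⟨_, ⟨i, rfl⟩, rfl⟩ := hq
    obtain ⟨⟨i', rfl⟩, -⟩ := hleast
    exact ⟨rfl, hC r i' i, hC r i i'⟩
  · exact absurd hq (Set.notMem_empty q)
  · obtain rfl : q = (r, j) := hq
    exact ⟨rfl, Nat.le_succ _, Nat.le_succ _⟩

variable [NeZero N] [NeZero R]

theorem step_swap_time (r r' : Fin R) (hr : (r' : ℕ) = r + 1) (j : Fin N) :
    step N R ((2 * r + 1) * N + (N - 1 - j) + 1) = Step.swap r r' j := by
  have hj : N - 1 - (j : ℕ) < N := by lia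
  have hcol : N - 1 - (N - 1 - (j : ℕ)) = j := by lia
  have hrow : (2 * (r : ℕ) + 1) / 2 = r := by lia
  simp [step, mul_add_div_of_lt hj, Nat.mul_add_mod_of_lt hj, hcol, hrow, ← hr]

theorem exists_gate_time_or_swap_time {s : ℕ} (hs : s < numSteps N R) :
    (∃ (r : Fin R) (j : Fin N), s = 2 * r * N + j) ∨
      ∃ (r r' : Fin R) (j : Fin N), (r' : ℕ) = r + 1 ∧ s = (2 * r + 1) * N + (N - 1 - j) := by
  have hR := Nat.pos_of_neZero R
  have hround {b : ℕ} (h : b * N ≤ s) : b < 2 * R - 1 :=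
    lt_of_mul_lt_mul_right (h.trans_lt hs) (Nat.zero_le N)
  obtain ⟨r, j, hj, h | h⟩ := exists_eq_gate_time_or_swap_time (N := N) s
  · have := hround (b := 2 * r) (by lia)
    exact .inl ⟨⟨r, by lia⟩, ⟨j, hj⟩, h⟩
  · have := hround (b := 2 * r + 1) (by lia)
    exact .inr ⟨⟨r, by lia⟩, ⟨r + 1, by lia⟩, ⟨j, hj⟩, rfl, h⟩

theorem dist_qubitPos_clockPos_le_of_mem_stepQubits (hC : C.NearestNeighbour) {s : ℕ}
    (hs : s < numSteps N R) {q : CompQubit N R} (hq : q ∈ C.stepQubits (step N R (s + 1))) :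
    dist (qubitPos (.inl q : Qubit N R)) (clockPos N s) ≤ (2 : ℕ) := by
  rw [dist_le_natCast_iff, abs_le, abs_le]
  obtain ⟨r, j, rfl⟩ | ⟨r, r', j, hr, rfl⟩ := exists_gate_time_or_swap_time hs
  · rw [step_gate_time] at hq
    obtain ⟨rfl, hj, hj'⟩ := C.mem_stepQubits_gate hC hq
    rw [clockPos_gate_time _ j.isLt, qubitPos]
    lia
  · rw [step_swap_time r r' hr] at hq
    rw [clockPos_swap_time _ j.isLt]
    obtain rfl | rfl : q = (r, j) ∨ q = (r', j) := hq <;>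
    · rw [qubitPos]
      lia

theorem dist_qubitPos_qout_le :
    dist (qubitPos (.inl (qout N R) : Qubit N R)) (clockPos N (numSteps N R - 1)) ≤ (1 : ℕ) := by
  have hN := Nat.pos_of_neZero N
  obtain ⟨R, rfl⟩ := Nat.exists_eq_succ_of_ne_zero (NeZero.ne R)
  have hT : numSteps N (R + 1) - 1 = 2 * R * N + (N - 1) := by grind [numSteps]
  rw [dist_le_natCast_iff, hT, clockPos_gate_time R (by lia)]
  simp [qubitPos, qout]

/-- The place around which the hyperedge of a term is drawn. -/
def home : C.TermIdx → ℤ × ℤ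
  | .inl q => qubitPos (.inl q.1 : Qubit N R)
  | .inr (.inl _) => clockPos N (numSteps N R - 1)
  | .inr (.inr (.inl s)) => clockPos N s
  | .inr (.inr (.inr s)) => clockPos N s

/-- The kind of a term: input, output, clock or evolution. -/
def termKind : C.TermIdx → Fin 4
  | .inl _ => 0
  | .inr (.inl _) => 1
  | .inr (.inr (.inl _)) => 2
  | .inr (.inr (.inr _)) => 3

theorem termKind_home_injective : Function.Injective fun i => (C.termKind i, C.home i) := by
  rintro (q | u | s | s) (q' | u' | s' | s') h <;>
    simp only [termKind, home, Prod.mk.injEq] at h <;>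
    try exact absurd h.1 (by decide)
  · exact congrArg _ (Subtype.ext (Sum.inl_injective (qubitPos_injective h.2)))
  · rfl
  · rw [Fin.ext (clockPos_injective h.2)]
  · rw [Fin.ext (clockPos_injective h.2)]

theorem dist_qubitPos_home_le (hC : C.NearestNeighbour) {i : C.TermIdx} {v : Qubit N R}
    (hv : v ∈ C.hyperedge i) : dist (qubitPos v) (C.home i) ≤ (6 : ℕ) := by
  have hT := numSteps_pos N R
  rcases i with q | u | s | s <;> obtain ⟨p, hp, rfl⟩ | ⟨s', hs', rfl⟩ := C.hyperedge_subset _ hv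
  · obtain rfl : p = q := hp
    simp [home]
  · obtain ⟨s, hs⟩ := C.exists_firstTime_eq_succ q
    have hq := (C.firstTime_mem q).2.2
    rw [hs] at hq
    simp only [termTime, hs, Nat.add_sub_cancel] at hs'
    refine (dist_triangle _ _ _).trans (add_le_add
      (dist_qubitPos_clockPos_le (Nat.le_succ _) (Nat.le_succ _) hs')
      ((dist_comm _ _).trans_le
        (C.dist_qubitPos_clockPos_le_of_mem_stepQubits hC s.isLt hq))) |>.trans ?_
    norm_num
  · obtain rfl : p = qout N R := hp
    exact dist_qubitPos_qout_le.trans (by norm_num)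
  · exact (dist_qubitPos_clockPos_le (Nat.sub_add_cancel hT).ge (by lia) hs').trans (by norm_num)
  · exact absurd hp (Set.notMem_empty p)
  · exact (dist_qubitPos_clockPos_le le_rfl (by lia) hs').trans (by norm_num)
  · exact (C.dist_qubitPos_clockPos_le_of_mem_stepQubits hC s.isLt hp).trans (by norm_num)
  · exact (dist_qubitPos_clockPos_le (Nat.le_succ _) (Nat.le_succ _) hs').trans (by norm_num)

theorem isSpatiallySparse_hyperedge (hC : C.NearestNeighbour) :
    IsSpatiallySparse C.hyperedge 9604 :=
  isSpatiallySparse_of_lattice_drawing (κ := Fin 4) (r := 6) qubitPos_injective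
    C.termKind_home_injective fun _ _ => C.dist_qubitPos_home_le hC

end VerifierCircuit

end

theorem lemma1 :
    ∃ c : ℝ, 0 < c ∧ ∃ K : ℕ,
      ∀ (N R : ℕ) [NeZero N] [NeZero R] (C : VerifierCircuit N R),
        C.hamiltonian.IsHermitian ∧
        (∀ i, (C.hyperedge i).encard ≤ 5) ∧
        (C.NearestNeighbour → IsSpatiallySparse C.hyperedge K) ∧
        (∀ (ε : ℝ) (ξ : Config C.inputs → ℂ), IsState ξ → 1 - ε < C.acceptProb ξ →
          (star (C.historyState ξ) ⬝ᵥ (C.hamiltonian *ᵥ C.historyState ξ)).re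
            < ε / ((numSteps N R : ℝ) + 1)) ∧
        (∀ ε : ℝ, (∀ ξ : Config C.inputs → ℂ, IsState ξ → C.acceptProb ξ < ε) →
          ∀ μ : ℝ, Module.End.HasEigenvalue (Matrix.toLin' C.hamiltonian) (μ : ℂ) →
            c * (1 - ε - Real.sqrt ε) / (numSteps N R : ℝ) ^ 3 ≤ μ) := by
  refine ⟨1 / 16, by norm_num, 9604, fun N R _ _ C => ⟨C.hamiltonian_isHermitian,
    C.encard_hyperedge_le, C.isSpatiallySparse_hyperedge, fun ε ξ hξ hacc => ?_,
    fun ε h μ hμ => C.le_of_hasEigenvalue h hμ⟩⟩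
  change energy C.hamiltonian (C.historyState ξ) < _
  rw [C.energy_historyState hξ]
  have : 1 - C.acceptProb ξ < ε := by linarith
  gcongr
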